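/- All graphs are finite and simple. For graphs $H,G$ let $\hom(H,G)$ be the number of homomorphisms from $H$ to $G$, i.e. of maps $\varphi:V(H)\to V(G)$ with $\{\varphi(u),\varphi(v)\}\in E(G)$ for every $\{u,v\}\in E(H)$. A graph $G$ is $\kappa$-degenerate if its vertices have an ordering $v_1,\dots,v_n$ in which each $v_i$ has at most $\kappa$ neighbours in $\{v_{i+1},\dots,v_n\}$. For a fixed graph $H$, the problem $\textsc{hom-cnt}_H$ is to compute $\hom(H,G)$ for an input graph $G$ with vertex set $\{0,\dots,n-1\}$, $n\ge 1$, given by $n$, its number of edges, and a list of its edges (each listed once, in arbitrary order and orientation). The problem is called easy if there are a randomized algorithm on the word RAM, a constant $c$ and a function $f:\mathbb N\to\mathbb N$ (all of which may depend on $H$, but not on $G$ or $n$) such that for all $\kappa\ge 0$, all $n\ge1$, every $\kappa$-degenerate graph $G$ on $n$ vertices and every edge list of $G$, the algorithm only ever handles non-negative integers of at most $c\,(\lfloor\log_2 n\rfloor+1)$ bits, always outputs $\hom(H,G)$ when it halts, and has expected running time at most $f(\kappa)\cdot n$ (in particular it halts with probability $1$). Here assigning a constant to a register, an arithmetic, bitwise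 or comparison operation on registers, reading or writing an array cell, drawing a uniformly random element of $\{0,\dots,x\}$ for a word $x$, and a control-flow step each take one unit of time. **Lemma.** Let $H$ be a graph. If $\textsc{hom-cnt}_H$ is easy, then $\textsc{hom-cnt}_{H'}$ is easy for every induced subgraph $H'$ of $H$. -/

import Mathlib

/-! ## Graph notions -/

/-- `G` is `κ`-degenerate: its vertices can be ordered (here: by distinct positions `pos v`) so
that every vertex has at most `κ` neighbours that come later in the ordering. -/
def IsDegenerate {V : Type*} [Finite V] (G : SimpleGraph V) (κ : ℕ) : Prop :=
  ∃ pos : V → ℕ, Function.Injective pos ∧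
    ∀ v, {w | G.Adj v w ∧ pos v < pos w}.ncard ≤ κ

/-- `es` lists every edge of `G` exactly once, in an arbitrary order, each edge with its two
endpoints in an arbitrary order. -/
def IsEdgeList {n : ℕ} (G : SimpleGraph (Fin n)) (es : List (Fin n × Fin n)) : Prop :=
  (es.map fun p => s(p.1, p.2)).Nodup ∧
    ∀ u v, G.Adj u v ↔ s(u, v) ∈ es.map fun p => s(p.1, p.2)

/-- The number `hom(H, G)` of homomorphisms from `H` to `G`. -/
noncomputable def homCount {V W : Type*} (H : SimpleGraph V) (G : SimpleGraph W) : ℕ :=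
  Nat.card (H →g G)

/-! ## The randomized word RAM

The memory consists of registers and of arrays, all of whose cells hold natural numbers.
A program is a fixed finite text (it does not depend on the input), so it uses a fixed finite
number of registers and arrays; it is written with structured control flow, which simulates jumps,
and is simulated by them, with constant-factor overhead. That all numbers fit into words of
`O(log n)` bits is required separately, in the definition of solving a problem below. -/

namespace WordRAM

/-- The unit-cost binary operations on words; comparisons return `0` or `1`. -/
inductive Op
  | add | sub | mul | div | mod | and | or | xor | shl | shr | lt | eq

/-- The value of an operation (subtraction is truncated at `0`; division by `0` gives `0`). -/
def Op.eval : Op → ℕ → ℕ → ℕ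
  | .add, a, b => a + b
  | .sub, a, b => a - b
  | .mul, a, b => a * b
  | .div, a, b => a / b
  | .mod, a, b => a % b
  | .and, a, b => a &&& b
  | .or, a, b => a ||| b
  | .xor, a, b => a ^^^ b
  | .shl, a, b => a <<< b
  | .shr, a, b => a >>> b
  | .lt, a, b => if a < b then 1 else 0
  | .eq, a, b => if a = b then 1 else 0

/-- Programs. Registers and arrays are named by natural numbers. -/
inductive Prog
  /-- do nothing -/
  | skip
  /-- `reg x := k` -/
  | const (x k : ℕ)
  /-- `reg x := o (reg y) (reg z)` -/
  | op (o : Op) (x y z : ℕ)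
  /-- `reg x := arr a [reg i]` -/
  | load (x a i : ℕ)
  /-- `arr a [reg i] := reg x` -/
  | store (a i x : ℕ)
  /-- `reg x :=` a fresh uniformly random element of `{0, …, reg y}` -/
  | rand (x y : ℕ)
  /-- first `p`, then `q` -/
  | seq (p q : Prog)
  /-- if `reg x ≠ 0` then `p` else `q` -/
  | ite (x : ℕ) (p q : Prog)
  /-- while `reg x ≠ 0` do `p` -/
  | loop (x : ℕ) (p : Prog)

/-- The contents of the memory. -/
structure Store where
  /-- the contents of the registers -/
  reg : ℕ → ℕ
  /-- the contents of the arrays: `arr a i` is the cell with index `i` of the array `a` -/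
  arr : ℕ → ℕ → ℕ

/-- Overwrite the register `x` by `v`. -/
def Store.setReg (s : Store) (x v : ℕ) : Store :=
  { s with reg := Function.update s.reg x v }

/-- Overwrite the cell with index `i` of the array `a` by `v`. -/
def Store.setArr (s : Store) (a i v : ℕ) : Store :=
  { s with arr := Function.update s.arr a (Function.update (s.arr a) i v) }

/-- All cells of the memory hold words of `w` bits. -/
def Store.FitsIn (s : Store) (w : ℕ) : Prop :=
  (∀ x, s.reg x < 2 ^ w) ∧ ∀ a i, s.arr a i < 2 ^ w

/-- A configuration: the list of the program parts that are still to be executed, in this order,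
and the memory. -/
structure Config where
  /-- what remains to be executed -/
  todo : List Prog
  /-- the memory -/
  mem : Store

/-- The machine has halted. -/
def Config.Halted (c : Config) : Prop := c.todo = []

/-- One step of the machine, as a probability distribution on the next configurations.
A halted configuration does not change. -/
noncomputable def step : Config → PMF Config
  | ⟨[], s⟩ => PMF.pure ⟨[], s⟩
  | ⟨.skip :: K, s⟩ => PMF.pure ⟨K, s⟩
  | ⟨.const x k :: K, s⟩ => PMF.pure ⟨K, s.setReg x k⟩
  | ⟨.op o x y z :: K, s⟩ => PMF.pure ⟨K, s.setReg x (o.eval (s.reg y) (s.reg z))⟩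
  | ⟨.load x a i :: K, s⟩ => PMF.pure ⟨K, s.setReg x (s.arr a (s.reg i))⟩
  | ⟨.store a i x :: K, s⟩ => PMF.pure ⟨K, s.setArr a (s.reg i) (s.reg x)⟩
  | ⟨.rand x y :: K, s⟩ =>
      (PMF.uniformOfFintype (Fin (s.reg y + 1))).map fun v => ⟨K, s.setReg x v⟩
  | ⟨.seq p q :: K, s⟩ => PMF.pure ⟨p :: q :: K, s⟩
  | ⟨.ite x p q :: K, s⟩ => PMF.pure ⟨(if s.reg x ≠ 0 then p else q) :: K, s⟩
  | ⟨.loop x p :: K, s⟩ => PMF.pure ⟨if s.reg x ≠ 0 then p :: .loop x p :: K else K, s⟩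

/-- The distribution of the configuration after `t` steps, starting from `c`. -/
noncomputable def run (c : Config) : ℕ → PMF Config
  | 0 => PMF.pure c
  | t + 1 => (run c t).bind step

/-- The expected number `E[T]` of steps until the machine halts, started from `c`, computed as
`∑ t ≥ 0, P(T > t)`; it is `∞` if the machine fails to halt with positive probability. -/
noncomputable def expectedTime (c : Config) : ENNReal :=
  ∑' t : ℕ, (run c t).toOuterMeasure {d | ¬ d.Halted}

/-- The initial memory for a graph with vertex set `{0, …, n - 1}` and list of edges `es`:
register `0` holds the number of vertices, register `1` holds the number of edges, and the arrays
`0` and `1` hold the first and the second endpoints of the edges. All other cells hold `0`. -/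
def inputStore (n : ℕ) (es : List (Fin n × Fin n)) : Store where
  reg x := if x = 0 then n else if x = 1 then es.length else 0
  arr a i :=
    if a = 0 then (es.map fun p => (p.1 : ℕ)).getD i 0
    else if a = 1 then (es.map fun p => (p.2 : ℕ)).getD i 0
    else 0

/-- The initial configuration of the program `P` on the graph given by `n` and `es`. -/
def init (P : Prog) (n : ℕ) (es : List (Fin n × Fin n)) : Config :=
  ⟨[P], inputStore n es⟩

/-- On the input given by `n` and `es`, with words of `w` bits, the Las Vegas algorithm `P`
computes the number `r` in expected time at most `T`: all numbers that ever occur are words of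
`w` bits, whenever the machine halts register `0` holds `r`, and the expected number of steps is
at most `T`. (Finite expected time includes halting with probability `1`.) -/
def Computes (P : Prog) (w n : ℕ) (es : List (Fin n × Fin n)) (r : ℕ) (T : ENNReal) : Prop :=
  (∀ t, ∀ c ∈ (run (init P n es) t).support, c.mem.FitsIn w) ∧
  (∀ t, ∀ c ∈ (run (init P n es) t).support, c.Halted → c.mem.reg 0 = r) ∧
  expectedTime (init P n es) ≤ T

end WordRAM

/-- The problem of computing `hom(H, G)` for a given input graph `G` is easy: a randomized
algorithm on the word RAM with words of `O(log n)` bits solves it, always correctly, in expected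
time at most `f κ * n` on all `κ`-degenerate input graphs with `n` vertices, for all `κ` and
all `n ≥ 1`. -/
def HomCntEasy {V : Type*} (H : SimpleGraph V) : Prop :=
  ∃ (P : WordRAM.Prog) (c : ℕ) (f : ℕ → ℕ),
    ∀ (κ n : ℕ), 1 ≤ n → ∀ G : SimpleGraph (Fin n), IsDegenerate G κ →
      ∀ es : List (Fin n × Fin n), IsEdgeList G es →
        WordRAM.Computes P (c * (Nat.log 2 n + 1)) n es (homCount H G) ((f κ * n : ℕ) : ENNReal)

namespace WordRAM

/-! Given `G` on `n` vertices, blow up `H`: replace each vertex in `S` by a copy of `V(G)` and keep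
every other vertex as a single point. Two points over adjacent vertices of `H` are joined, except
that over two vertices of `S` their coordinates must also be adjacent in `G`. A homomorphism from
`H` to the blow-up that meets every fiber projects to a surjective, hence bijective, endomorphism of
the finite graph `H`, that is, to an automorphism. Undoing the automorphism leaves a section of the
projection, and sections are the homomorphisms `H.induce S →g G` (`card_surjective_hom`,
`card_section`). So the homomorphisms meeting every fiber number `|Aut H|` times the wanted count,
and inclusion-exclusion over the sets `T` of allowed fibers expresses their number through `hom(H,
·)` of the parts of the blow-up over `T` (`sum_homCount_blowup`).

With `k = |V|`, these parts have at most `k * n` vertices and are `(k * κ + k)`-degenerate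
(`IsDegenerate.blowup`), so the given algorithm is linear on each of the at most `2 ^ k` of them.
Their edge lists can be written in time linear in `n` plus the number of edges, by a program that
depends only on `H` and `S` and need not know `κ`.

The rest makes this precise on the machine. `Spec` is a program logic for word size, result and
expected time; `Spec.append` composes programs, and `Spec.rename` runs each call of the given
algorithm in private memory. `computes_mainProg` gathers the calls in two accumulators, one per
sign, then subtracts and divides by `|Aut H|`. -/

/-! ### A program logic for randomized programs with expected running time -/

theorem run_succ_left (c : Config) (t : ℕ) :
    run c (t + 1) = (step c).bind fun d => run d t := by
  induction t with
  | zero => simp [run]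
  | succ t ih =>
    rw [run, ih, PMF.bind_bind]
    rfl

/-- The expected number of steps among the first `N` ones. -/
noncomputable def truncTime (c : Config) (N : ℕ) : ENNReal :=
  ∑ t ∈ Finset.range N, (run c t).toOuterMeasure {d | ¬ d.Halted}

/-- Time bounds are proved for the truncated sums, by induction on `N`, and pass to the supremum. -/
theorem expectedTime_eq_iSup (c : Config) : expectedTime c = ⨆ N, truncTime c N :=
  ENNReal.tsum_eq_iSup_nat

theorem truncTime_le_expectedTime (c : Config) (N : ℕ) : truncTime c N ≤ expectedTime c :=
  ENNReal.sum_le_tsum _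

theorem truncTime_succ {c : Config} (hc : ¬ c.Halted) (N : ℕ) :
    truncTime c (N + 1) = 1 + ∑' d, step c d * truncTime d N := by
  have h0 : (run c 0).toOuterMeasure {d | ¬ d.Halted} = 1 := by
    rw [run, PMF.toOuterMeasure_pure_apply]
    simp [hc]
  rw [truncTime, Finset.sum_range_succ', h0, add_comm]
  congr 1
  simp_rw [run_succ_left, PMF.toOuterMeasure_bind_apply, truncTime, Finset.mul_sum]
  rw [Summable.tsum_finsetSum fun _ _ => ENNReal.summable]

/-- Started from `c`, the machine only uses words of `w` bits, it satisfies `Q` when it halts, and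
its expected running time is at most `T`. -/
structure Spec (c : Config) (w T : ℕ) (Q : Store → Prop) : Prop where
  fits : ∀ t, ∀ d ∈ (run c t).support, d.mem.FitsIn w
  post : ∀ t, ∀ d ∈ (run c t).support, d.Halted → Q d.mem
  time : expectedTime c ≤ T

theorem Spec.mono {c : Config} {w w' T T' : ℕ} {Q Q' : Store → Prop}
    (h : Spec c w T Q) (hw : w ≤ w') (hT : T ≤ T') (hQ : ∀ s, Q s → s.FitsIn w → Q' s) :
    Spec c w' T' Q' where
  fits t d hd :=
    have hp := Nat.pow_le_pow_right (n := 2) (by norm_num) hw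
    ⟨fun x => ((h.fits t d hd).1 x).trans_le hp, fun a i => ((h.fits t d hd).2 a i).trans_le hp⟩
  post t d hd hh := hQ _ (h.post t d hd hh) (h.fits t d hd)
  time := h.time.trans (mod_cast hT)

theorem run_halted (s : Store) (t : ℕ) : run ⟨[], s⟩ t = PMF.pure ⟨[], s⟩ := by
  induction t with
  | zero => rfl
  | succ t ih => rw [run, ih, PMF.pure_bind]; rfl

theorem Spec.nil {s : Store} {w : ℕ} {Q : Store → Prop} (hs : s.FitsIn w) (hQ : Q s)
    (T : ℕ) : Spec ⟨[], s⟩ w T Q where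
  fits t d hd := by
    rw [run_halted, PMF.support_pure, Set.mem_singleton_iff] at hd
    exact hd ▸ hs
  post t d hd _ := by
    rw [run_halted, PMF.support_pure, Set.mem_singleton_iff] at hd
    exact hd ▸ hQ
  time := by
    simp only [expectedTime, run_halted, PMF.toOuterMeasure_pure_apply]
    simp [Config.Halted]

theorem Spec.of_step {c d : Config} {w T : ℕ} {Q : Store → Prop}
    (hstep : step c = PMF.pure d) (hc : ¬ c.Halted) (hfit : c.mem.FitsIn w)
    (h : Spec d w T Q) : Spec c w (T + 1) Q where
  fits t e he := by
    cases t with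
    | zero =>
      rw [run, PMF.support_pure, Set.mem_singleton_iff] at he
      exact he ▸ hfit
    | succ t =>
      rw [run_succ_left, hstep, PMF.pure_bind] at he
      exact h.fits t e he
  post t e he hh := by
    cases t with
    | zero =>
      rw [run, PMF.support_pure, Set.mem_singleton_iff] at he
      exact absurd (he ▸ hh) hc
    | succ t =>
      rw [run_succ_left, hstep, PMF.pure_bind] at he
      exact h.post t e he hh
  time := by
    rw [expectedTime_eq_iSup]
    refine iSup_le fun N => ?_
    cases N with
    | zero => simp [truncTime]
    | succ N =>
      rw [truncTime_succ hc, hstep, add_comm, Nat.cast_succ]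
      gcongr
      rw [tsum_eq_single d]
      · simpa using (truncTime_le_expectedTime d N).trans h.time
      · intro e he
        simp [he]

/-- A step inspects only the head of the list, so the continuation `L` is carried along untouched.
For empty `K` the step would already be one of `L`. -/
theorem step_append {K : List Prog} (hK : K ≠ []) (L : List Prog) (s : Store) :
    step ⟨K ++ L, s⟩ = (step ⟨K, s⟩).map fun c => ⟨c.todo ++ L, c.mem⟩ := by
  obtain ⟨p, K, rfl⟩ := List.exists_cons_of_ne_nil hK
  cases p <;> simp only [List.cons_append, step, PMF.pure_map, PMF.map_comp]
  case rand => rfl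
  case loop => split_ifs <;> rfl

/-- Safety passes to every possible successor. A bound on the expected time does not pass on
unchanged, as a single successor may be slower than the average; hence only two of the fields of
`Spec` appear. -/
theorem Spec.mem_step {c d : Config} {w : ℕ} {Q : Store → Prop}
    (h : (∀ t, ∀ d ∈ (run c t).support, d.mem.FitsIn w) ∧
      ∀ t, ∀ d ∈ (run c t).support, d.Halted → Q d.mem) (hd : d ∈ (step c).support) :
    (∀ t, ∀ e ∈ (run d t).support, e.mem.FitsIn w) ∧
      ∀ t, ∀ e ∈ (run d t).support, e.Halted → Q e.mem := by
  have key : ∀ t, ∀ e ∈ (run d t).support, e ∈ (run c (t + 1)).support := by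
    intro t e he
    rw [run_succ_left, PMF.mem_support_bind_iff]
    exact ⟨d, hd, he⟩
  exact ⟨fun t e he => h.1 _ e (key t e he), fun t e he => h.2 _ e (key t e he)⟩

theorem self_mem_support_run (c : Config) : c ∈ (run c 0).support := by
  simp [run]

/-- Expected times add even though the moment when `K` ends is random. The induction compares with
the truncated time of `K` itself instead of `T₁`, since after a random step nothing bounds the
remaining time of `K` along an individual branch. -/
theorem Spec.append {K L : List Prog} {s : Store} {w T₁ T₂ : ℕ}
    {Q₁ Q₂ : Store → Prop} (h : Spec ⟨K, s⟩ w T₁ Q₁)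
    (h' : ∀ s', Q₁ s' → s'.FitsIn w → Spec ⟨L, s'⟩ w T₂ Q₂) :
    Spec ⟨K ++ L, s⟩ w (T₁ + T₂) Q₂ := by
  have key : ∀ t, ∀ (K : List Prog) (s : Store),
      ((∀ t, ∀ d ∈ (run ⟨K, s⟩ t).support, d.mem.FitsIn w) ∧
        ∀ t, ∀ d ∈ (run ⟨K, s⟩ t).support, d.Halted → Q₁ d.mem) →
      (∀ d ∈ (run ⟨K ++ L, s⟩ t).support, d.mem.FitsIn w ∧ (d.Halted → Q₂ d.mem)) ∧
        truncTime ⟨K ++ L, s⟩ t ≤ truncTime ⟨K, s⟩ t + T₂ := by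
    intro t
    induction t with
    | zero =>
      intro K s hK
      refine ⟨fun d hd => ?_, by simp [truncTime]⟩
      rw [run, PMF.support_pure, Set.mem_singleton_iff] at hd
      subst hd
      refine ⟨hK.1 0 ⟨K, s⟩ (self_mem_support_run _), fun hh => ?_⟩
      obtain ⟨rfl, rfl⟩ : K = [] ∧ L = [] := List.append_eq_nil_iff.1 hh
      have hs := self_mem_support_run ⟨[], s⟩
      exact (h' s (hK.2 0 _ hs rfl) (hK.1 0 _ hs)).post 0 _ hs rfl
    | succ t ih =>
      intro K s hK
      rcases eq_or_ne K [] with rfl | hne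
      · have hs := self_mem_support_run ⟨[], s⟩
        have := h' s (hK.2 0 _ hs rfl) (hK.1 0 _ hs)
        exact ⟨fun d hd => ⟨this.fits _ d hd, this.post _ d hd⟩,
          ((truncTime_le_expectedTime _ _).trans this.time).trans le_add_self⟩
      · have hc : ¬ (Config.Halted ⟨K, s⟩) := hne
        have hc' : ¬ (Config.Halted ⟨K ++ L, s⟩) := by simp [Config.Halted, hne]
        constructor
        · intro d hd
          rw [run_succ_left, step_append hne, PMF.bind_map, PMF.mem_support_bind_iff] at hd
          obtain ⟨e, he, hd⟩ := hd
          exact (ih e.todo e.mem (Spec.mem_step hK he)).1 d hd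
        · rw [truncTime_succ hc, truncTime_succ hc', step_append hne, add_assoc]
          gcongr
          have e1 : ∑' d, ((step ⟨K, s⟩).map fun c => (⟨c.todo ++ L, c.mem⟩ : Config)) d *
              truncTime d t = ∑' e, step ⟨K, s⟩ e * truncTime ⟨e.todo ++ L, e.mem⟩ t := by
            simp_rw [PMF.map_apply, ← ENNReal.tsum_mul_right]
            rw [ENNReal.tsum_comm]
            refine tsum_congr fun e => ?_
            rw [tsum_eq_single (⟨e.todo ++ L, e.mem⟩ : Config)]
            · simp
            · intro d hd
              simp [hd]
          rw [e1]
          calc _ ≤ ∑' e, (step ⟨K, s⟩ e * truncTime e t + step ⟨K, s⟩ e * T₂) := by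
                refine ENNReal.tsum_le_tsum fun e => ?_
                rw [← mul_add]
                -- The induction hypothesis is only available on the support; elsewhere the weight
                -- is zero.
                by_cases he : e ∈ (step ⟨K, s⟩).support
                · gcongr
                  exact (ih e.todo e.mem (Spec.mem_step hK he)).2
                · rw [PMF.mem_support_iff, not_not] at he
                  simp [he]
            _ = _ := by
                rw [ENNReal.tsum_add, ENNReal.tsum_mul_right, PMF.tsum_coe, one_mul]
  refine ⟨fun t d hd => ((key t K s ⟨h.fits, h.post⟩).1 d hd).1,
    fun t d hd => ((key t K s ⟨h.fits, h.post⟩).1 d hd).2, ?_⟩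
  rw [expectedTime_eq_iSup]
  refine iSup_le fun N => (key N K s ⟨h.fits, h.post⟩).2.trans ?_
  rw [Nat.cast_add]
  gcongr
  exact (truncTime_le_expectedTime _ _).trans h.time

/-! ### Rules for the single commands -/

section Rules

variable {K : List Prog} {s : Store} {w T : ℕ} {Q : Store → Prop}

theorem Store.FitsIn.setReg (hs : s.FitsIn w) {v : ℕ} (hv : v < 2 ^ w) (x : ℕ) :
    (s.setReg x v).FitsIn w := by
  refine ⟨fun y => ?_, hs.2⟩
  simp only [Store.setReg, Function.update_apply]
  split_ifs
  exacts [hv, hs.1 y]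

theorem Store.FitsIn.setArr (hs : s.FitsIn w) {v : ℕ} (hv : v < 2 ^ w) (a i : ℕ) :
    (s.setArr a i v).FitsIn w := by
  refine ⟨hs.1, fun b j => ?_⟩
  by_cases hb : b = a
  · subst hb
    simp only [Store.setArr, Function.update_self, Function.update_apply]
    split_ifs
    exacts [hv, hs.2 b j]
  · simpa [Store.setArr, hb] using hs.2 b j

theorem Store.FitsIn.mono {w' : ℕ} (hs : s.FitsIn w) (h : w ≤ w') : s.FitsIn w' :=
  have hp := Nat.pow_le_pow_right (n := 2) (by norm_num) h
  ⟨fun x => (hs.1 x).trans_le hp, fun a i => (hs.2 a i).trans_le hp⟩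

theorem Spec.const {x k : ℕ} (hs : s.FitsIn w) (h : Spec ⟨K, s.setReg x k⟩ w T Q) :
    Spec ⟨.const x k :: K, s⟩ w (T + 1) Q :=
  Spec.of_step rfl (List.cons_ne_nil _ _) hs h

theorem Spec.op {o : Op} {x y z : ℕ} (hs : s.FitsIn w)
    (h : Spec ⟨K, s.setReg x (o.eval (s.reg y) (s.reg z))⟩ w T Q) :
    Spec ⟨.op o x y z :: K, s⟩ w (T + 1) Q :=
  Spec.of_step rfl (List.cons_ne_nil _ _) hs h

theorem Spec.load {x a i : ℕ} (hs : s.FitsIn w)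
    (h : Spec ⟨K, s.setReg x (s.arr a (s.reg i))⟩ w T Q) :
    Spec ⟨.load x a i :: K, s⟩ w (T + 1) Q :=
  Spec.of_step rfl (List.cons_ne_nil _ _) hs h

theorem Spec.store {a i x : ℕ} (hs : s.FitsIn w)
    (h : Spec ⟨K, s.setArr a (s.reg i) (s.reg x)⟩ w T Q) :
    Spec ⟨.store a i x :: K, s⟩ w (T + 1) Q :=
  Spec.of_step rfl (List.cons_ne_nil _ _) hs h

theorem Spec.skip (hs : s.FitsIn w) (h : Spec ⟨K, s⟩ w T Q) :
    Spec ⟨.skip :: K, s⟩ w (T + 1) Q :=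
  Spec.of_step rfl (List.cons_ne_nil _ _) hs h

theorem Spec.seq {p q : Prog} (hs : s.FitsIn w) (h : Spec ⟨p :: q :: K, s⟩ w T Q) :
    Spec ⟨.seq p q :: K, s⟩ w (T + 1) Q :=
  Spec.of_step rfl (List.cons_ne_nil _ _) hs h

theorem Spec.loop_of_eq_zero {x : ℕ} {p : Prog} (hs : s.FitsIn w) (hx : s.reg x = 0)
    (h : Spec ⟨K, s⟩ w T Q) : Spec ⟨.loop x p :: K, s⟩ w (T + 1) Q :=
  Spec.of_step (by simp [step, hx]) (List.cons_ne_nil _ _) hs h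

theorem Spec.loop_of_ne_zero {x : ℕ} {p : Prog} (hs : s.FitsIn w) (hx : s.reg x ≠ 0)
    (h : Spec ⟨p :: .loop x p :: K, s⟩ w T Q) : Spec ⟨.loop x p :: K, s⟩ w (T + 1) Q :=
  Spec.of_step (by simp [step, hx]) (List.cons_ne_nil _ _) hs h

end Rules

/-- The commands of a list, one after the other. -/
def Prog.block : List Prog → Prog
  | [] => .skip
  | p :: l => .seq p (Prog.block l)

theorem Spec.block_nil {K : List Prog} {s : Store} {w T : ℕ} {Q : Store → Prop}
    (hs : s.FitsIn w) (h : Spec ⟨K, s⟩ w T Q) : Spec ⟨Prog.block [] :: K, s⟩ w (T + 1) Q :=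
  Spec.skip hs h

theorem Spec.block_cons {p : Prog} {l K : List Prog} {s : Store} {w T : ℕ} {Q : Store → Prop}
    (hs : s.FitsIn w) (h : Spec ⟨p :: Prog.block l :: K, s⟩ w T Q) :
    Spec ⟨Prog.block (p :: l) :: K, s⟩ w (T + 1) Q :=
  Spec.seq hs h

/-! ### Renaming registers and arrays -/

/-- The program with all registers renamed by `ρ` and all arrays renamed by `α`. -/
def Prog.rename (ρ α : ℕ → ℕ) : Prog → Prog
  | .skip => .skip
  | .const x k => .const (ρ x) k
  | .op o x y z => .op o (ρ x) (ρ y) (ρ z)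
  | .load x a i => .load (ρ x) (α a) (ρ i)
  | .store a i x => .store (α a) (ρ i) (ρ x)
  | .rand x y => .rand (ρ x) (ρ y)
  | .seq p q => .seq (p.rename ρ α) (q.rename ρ α)
  | .ite x p q => .ite (ρ x) (p.rename ρ α) (q.rename ρ α)
  | .loop x p => .loop (ρ x) (p.rename ρ α)

/-- The memory `s₀`, where the registers and arrays with names in the images of `ρ` and `α` are
overwritten by the memory `s`. -/
noncomputable def Store.lift (ρ α : ℕ → ℕ) (s s₀ : Store) : Store where
  reg := Function.extend ρ s.reg s₀.reg
  arr := Function.extend α s.arr s₀.arr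

/-- The configuration of the renamed program. -/
noncomputable def Config.lift (ρ α : ℕ → ℕ) (s₀ : Store) (c : Config) : Config :=
  ⟨c.todo.map (Prog.rename ρ α), c.mem.lift ρ α s₀⟩

theorem extend_update {ρ : ℕ → ℕ} (hρ : ρ.Injective) {β : Type*} (f g : ℕ → β) (x : ℕ) (v : β) :
    Function.extend ρ (Function.update f x v) g =
      Function.update (Function.extend ρ f g) (ρ x) v := by
  funext y
  by_cases hy : ∃ z, ρ z = y
  · obtain ⟨z, rfl⟩ := hy
    by_cases hz : z = x
    · subst hz; simp [hρ.extend_apply]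
    · simp [hρ.extend_apply, hz, hρ.ne hz]
  · have : y ≠ ρ x := fun h => hy ⟨x, h.symm⟩
    simp [Function.extend_apply' _ _ _ hy, this]

section Rename

variable {ρ α : ℕ → ℕ} (hρ : ρ.Injective) (hα : α.Injective) (s₀ : Store)
include hρ hα

omit hα in
theorem Store.lift_setReg (s : Store) (x v : ℕ) :
    Store.lift ρ α (s.setReg x v) s₀ = (Store.lift ρ α s s₀).setReg (ρ x) v := by
  simp [Store.lift, Store.setReg, extend_update hρ]

omit hρ in
theorem Store.lift_setArr (s : Store) (a i v : ℕ) :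
    Store.lift ρ α (s.setArr a i v) s₀ = (Store.lift ρ α s s₀).setArr (α a) i v := by
  simp [Store.lift, Store.setArr, extend_update hα, hα.extend_apply]

/-- Injectivity keeps distinct cells distinct, so reads and writes commute with the renaming. -/
theorem step_lift (c : Config) :
    step (c.lift ρ α s₀) = (step c).map (Config.lift ρ α s₀) := by
  obtain ⟨K, s⟩ := c
  have hreg : ∀ x, (Store.lift ρ α s s₀).reg (ρ x) = s.reg x := fun x => hρ.extend_apply _ _ _
  have harr : ∀ a, (Store.lift ρ α s s₀).arr (α a) = s.arr a := fun a => hα.extend_apply _ _ _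
  cases K with
  | nil => simp [Config.lift, step, PMF.pure_map]
  | cons p K =>
    cases p <;>
      simp only [Config.lift, List.map_cons, Prog.rename, step, PMF.pure_map, PMF.map_comp, hreg,
        harr, Store.lift_setReg hρ, Store.lift_setArr hα]
    case rand =>
      congr 1
      · funext v
        simp [Config.lift, Store.lift_setReg hρ]
      -- The type of the uniform draw depends on the bound in the register, so the equality of the
      -- two bounds is generalized and substituted.
      · have : ∀ M N : ℕ, M = N →
            ((PMF.uniformOfFintype (Fin (M + 1)) >>= fun a => pure (a : ℕ)) : PMF ℕ) =
              PMF.uniformOfFintype (Fin (N + 1)) >>= fun a => pure (a : ℕ) := by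
          rintro M _ rfl
          rfl
        exact this _ _ (hreg _)
    case ite | loop => split_ifs <;> simp [Prog.rename]

theorem run_lift (c : Config) (t : ℕ) :
    run (c.lift ρ α s₀) t = (run c t).map (Config.lift ρ α s₀) := by
  induction t with
  | zero => simp [run, PMF.pure_map]
  | succ t ih =>
    rw [run, run, ih, PMF.bind_map, PMF.map_bind]
    congr 1
    funext d
    exact step_lift hρ hα s₀ d

/-- The renamed run is the image of the original one and halts at the same times. The postcondition
doubles as a frame rule: outside the images of `ρ` and `α` the memory is still `s₀`. -/
theorem Spec.rename {c : Config} {w T : ℕ} {Q : Store → Prop} (h : Spec c w T Q)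
    (hs₀ : s₀.FitsIn w) :
    Spec (c.lift ρ α s₀) w T fun s => ∃ s', Q s' ∧ s = s'.lift ρ α s₀ where
  fits t d hd := by
    rw [run_lift hρ hα, PMF.mem_support_map_iff] at hd
    obtain ⟨e, he, rfl⟩ := hd
    have hf := h.fits t e he
    refine ⟨fun x => ?_, fun a => ?_⟩
    · by_cases hx : ∃ z, ρ z = x
      · obtain ⟨z, rfl⟩ := hx
        simpa [Config.lift, Store.lift, hρ.extend_apply] using hf.1 z
      · simpa [Config.lift, Store.lift, Function.extend_apply' _ _ _ hx] using hs₀.1 x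
    · by_cases hx : ∃ z, α z = a
      · obtain ⟨z, rfl⟩ := hx
        simpa [Config.lift, Store.lift, hα.extend_apply] using hf.2 z
      · simpa [Config.lift, Store.lift, Function.extend_apply' _ _ _ hx] using hs₀.2 a
  post t d hd hh := by
    rw [run_lift hρ hα, PMF.mem_support_map_iff] at hd
    obtain ⟨e, he, rfl⟩ := hd
    exact ⟨e.mem, h.post t e he (List.map_eq_nil_iff.1 hh), rfl⟩
  time := by
    refine le_trans (le_of_eq ?_) h.time
    unfold expectedTime
    refine tsum_congr fun t => ?_
    rw [run_lift hρ hα, PMF.toOuterMeasure_map_apply]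
    congr 1
    ext d
    simp [Config.Halted, Config.lift]

end Rename

end WordRAM

namespace WordRAM

/-! ### Reading an updated memory -/

@[simp] theorem Store.reg_setReg (s : Store) (x v y : ℕ) :
    (s.setReg x v).reg y = if y = x then v else s.reg y := by
  simp [Store.setReg, Function.update_apply]

@[simp] theorem Store.arr_setReg (s : Store) (x v : ℕ) : (s.setReg x v).arr = s.arr := rfl

@[simp] theorem Store.reg_setArr (s : Store) (a i v : ℕ) : (s.setArr a i v).reg = s.reg := rfl

@[simp] theorem Store.arr_setArr (s : Store) (a i v b k : ℕ) :
    (s.setArr a i v).arr b k = if b = a ∧ k = i then v else s.arr b k := by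
  by_cases hb : b = a
  · subst hb
    simp [Store.setArr, Function.update_apply]
  · simp [Store.setArr, hb]

/-! ### Memory layout

Registers and arrays with names below `12` belong to the main program, the others are divided
among the copies of a subprogram. -/

/-- The name of the register or array `x` of the copy with number `j`. -/
def slot (j x : ℕ) : ℕ := 12 + Nat.pair j x

theorem slot_inj {j x j' x' : ℕ} : slot j x = slot j' x' ↔ j = j' ∧ x = x' := by
  simp [slot, Nat.pair_eq_pair]

theorem slot_injective (j : ℕ) : (slot j).Injective := fun _ _ h => (slot_inj.1 h).2

theorem slot_ne {k : ℕ} (hk : k < 12) (j x : ℕ) : slot j x ≠ k := by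
  unfold slot; omega

theorem ne_slot {k : ℕ} (hk : k < 12) (j x : ℕ) : k ≠ slot j x := (slot_ne hk j x).symm

/-- The registers that hold intermediate results. -/
def IsScratch (x : ℕ) : Prop := 3 ≤ x ∧ x < 9 ∨ x = 11

/-- The state of the main program: the registers `0`, `1`, `2` hold `n`, `m` and `1`, the arrays
below `4` hold `F`, the accumulators `9` and `10` hold `A` and `B`, the memory of the copy `j` is
the input with `N` vertices and the edges in `l`, and the memory of all later copies is empty. -/
structure Inv (n m : ℕ) (F : ℕ → ℕ → ℕ) (w j N : ℕ) (l : List (ℕ × ℕ)) (A B : ℕ) (s : Store) :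
    Prop where
  fits : s.FitsIn w
  reg0 : s.reg 0 = n
  reg1 : s.reg 1 = m
  reg2 : s.reg 2 = 1
  reg9 : s.reg 9 = A
  reg10 : s.reg 10 = B
  src : ∀ a < 4, s.arr a = F a
  curReg : ∀ x, s.reg (slot j x) = if x = 0 then N else if x = 1 then l.length else 0
  curArr : ∀ a i, s.arr (slot j a) i =
    if a = 0 then (l.map Prod.fst).getD i 0 else if a = 1 then (l.map Prod.snd).getD i 0 else 0
  freshReg : ∀ j', j < j' → ∀ x, s.reg (slot j' x) = 0
  freshArr : ∀ j', j < j' → ∀ a i, s.arr (slot j' a) i = 0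

section Building

variable {n m : ℕ} {F : ℕ → ℕ → ℕ} {w j N : ℕ} {l : List (ℕ × ℕ)} {A B : ℕ} {s : Store}

theorem Inv.one_lt (h : Inv n m F w j N l A B s) : 1 < 2 ^ w := h.reg2 ▸ h.fits.1 2

theorem Inv.setReg (h : Inv n m F w j N l A B s) {x v : ℕ} (hx : IsScratch x) (hv : v < 2 ^ w) :
    Inv n m F w j N l A B (s.setReg x v) := by
  have hx' : x < 12 := by unfold IsScratch at hx; omega
  have h0 : 0 ≠ x ∧ 1 ≠ x ∧ 2 ≠ x ∧ 9 ≠ x ∧ 10 ≠ x := by unfold IsScratch at hx; omega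
  obtain ⟨h0, h1, h2, h9, h10⟩ := h0
  exact
    { fits := h.fits.setReg hv x
      reg0 := by simp [h0, h.reg0]
      reg1 := by simp [h1, h.reg1]
      reg2 := by simp [h2, h.reg2]
      reg9 := by simp [h9, h.reg9]
      reg10 := by simp [h10, h.reg10]
      src := h.src
      curReg := fun y => by simp [slot_ne hx', h.curReg]
      curArr := h.curArr
      freshReg := fun j' hj y => by simp [slot_ne hx', h.freshReg j' hj]
      freshArr := h.freshArr }

/-- The default `0` beyond the end of the list matches the content of an unwritten cell. -/
theorem getD_concat (l : List ℕ) (x i : ℕ) :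
    (l ++ [x])[i]?.getD 0 = if i = l.length then x else l[i]?.getD 0 := by
  simp only [List.getElem?_append]
  split_ifs with h1 h2 h2
  · omega
  · rfl
  · simp [h2]
  · have : l.length < i := by omega
    have h3 : i - l.length ≠ 0 := by omega
    simp [List.getElem?_eq_none this.le, h3]

/-- Appending an edge to the input of the current copy. -/
theorem Inv.concat (h : Inv n m F w j N l A B s) {x y : ℕ} (hx : x < 2 ^ w) (hy : y < 2 ^ w)
    (hl : l.length + 1 < 2 ^ w) :
    Inv n m F w j N (l ++ [(x, y)]) A B
      (((s.setArr (slot j 0) l.length x).setArr (slot j 1) l.length y).setReg (slot j 1)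
        (l.length + 1)) where
  fits := ((h.fits.setArr hx _ _).setArr hy _ _).setReg hl _
  reg0 := by simp [ne_slot, h.reg0]
  reg1 := by simp [ne_slot, h.reg1]
  reg2 := by simp [ne_slot, h.reg2]
  reg9 := by simp [ne_slot, h.reg9]
  reg10 := by simp [ne_slot, h.reg10]
  src a ha := by
    funext i
    simp [ne_slot (show a < 12 by omega), h.src a ha]
  curReg z := by
    by_cases hz : z = 1
    · simp [hz]
    · simp [slot_inj, hz, h.curReg]
  curArr a i := by
    by_cases h0 : a = 0
    · subst h0
      simp [slot_inj, getD_concat, h.curArr]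
    · by_cases h1 : a = 1
      · subst h1
        simp [slot_inj, getD_concat, h.curArr]
      · simp [slot_inj, h0, h1, h.curArr]
  freshReg j' hj z := by simp [slot_inj, hj.ne', h.freshReg j' hj]
  freshArr j' hj a i := by simp [slot_inj, hj.ne', h.freshArr j' hj]

/-- Set the register `x` to `a * n + b`. -/
def setLinear (x a b : ℕ) : Prog :=
  .block [.const 7 a, .op .mul 7 7 0, .const 8 b, .op .add x 7 8]

/-- In a block each command costs one step for itself and one for its `seq`, and the final `skip`
costs one more: `2 * 4 + 1 = 9`. -/
theorem Inv.setLinear (h : Inv n m F w j N l A B s) (hn : 1 ≤ n) {x a b : ℕ} (hx : IsScratch x)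
    (hab : a * n + b < 2 ^ w) :
    Spec ⟨[setLinear x a b], s⟩ w 9 fun s' => Inv n m F w j N l A B s' ∧
      s'.reg x = a * n + b ∧ ∀ y, y ≠ x → y ≠ 7 → y ≠ 8 → s'.reg y = s.reg y := by
  -- The constant `a` is held in a register before the multiplication; it fits because `a ≤ a * n`.
  have ha : a < 2 ^ w := by nlinarith
  have han : a * n < 2 ^ w := by omega
  have hb : b < 2 ^ w := by omega
  have h7 : IsScratch 7 := by unfold IsScratch; omega
  have h8 : IsScratch 8 := by unfold IsScratch; omega
  have h1 := h.setReg h7 ha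
  have h2 := h1.setReg h7 han
  have h3 := h2.setReg h8 hb
  have h4 := h3.setReg hx hab
  refine Spec.block_cons h.fits (Spec.const h.fits ?_)
  refine Spec.block_cons h1.fits (Spec.op h1.fits ?_)
  have e2 : Op.mul.eval ((s.setReg 7 a).reg 7) ((s.setReg 7 a).reg 0) = a * n := by
    simp [Op.eval, h.reg0]
  rw [e2]
  refine Spec.block_cons h2.fits (Spec.const h2.fits ?_)
  refine Spec.block_cons h3.fits (Spec.op h3.fits ?_)
  simp only [Op.eval, Store.reg_setReg, if_true, show (7 : ℕ) ≠ 8 by norm_num, if_false]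
  refine Spec.block_nil h4.fits (Spec.nil h4.fits ⟨h4, by simp, ?_⟩ 0)
  intro y hyx hy7 hy8
  simp [hyx, hy7, hy8]

/-! ### Copying edges -/

/-- The description of a list of edges that is to be appended to the current input. -/
structure Source where
  /-- the array with the first endpoints -/
  fst : ℕ
  /-- the array with the second endpoints -/
  snd : ℕ
  /-- the register with the number of edges -/
  len : ℕ
  /-- the offset of the first endpoints is a linear function of `n` -/
  slope₁ : ℕ
  /-- its constant term -/
  shift₁ : ℕ
  /-- the offset of the second endpoints is a linear function of `n` -/
  slope₂ : ℕ
  /-- its constant term -/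
  shift₂ : ℕ

/-- The value of the registers `0`, `1`, `2`. -/
def regVal (n m x : ℕ) : ℕ := if x = 0 then n else if x = 1 then m else 1

theorem Inv.reg_eq (h : Inv n m F w j N l A B s) {x : ℕ} (hx : x < 3) : s.reg x = regVal n m x := by
  interval_cases x <;> simp [regVal, h.reg0, h.reg1, h.reg2]

theorem regVal_le (n m x : ℕ) : regVal n m x ≤ n + m + 1 := by
  unfold regVal; split_ifs <;> omega

/-- The edges described by a source. -/
def Source.edge (b : Source) (n : ℕ) (F : ℕ → ℕ → ℕ) (i : ℕ) : ℕ × ℕ :=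
  (F b.fst i + (b.slope₁ * n + b.shift₁), F b.snd i + (b.slope₂ * n + b.shift₂))

/-- The list of edges described by a source. -/
def Source.edges (b : Source) (n m : ℕ) (F : ℕ → ℕ → ℕ) : List (ℕ × ℕ) :=
  (List.range (regVal n m b.len)).map (b.edge n F)

/-- Append a single edge to the input of the copy `j`. -/
def Source.copyOne (b : Source) (j : ℕ) : Prog :=
  .block [.load 7 b.fst 5, .op .add 7 7 3, .load 8 b.snd 5, .op .add 8 8 4,
    .store (slot j 0) (slot j 1) 7, .store (slot j 1) (slot j 1) 8,
    .op .add (slot j 1) (slot j 1) 2, .op .add 5 5 2, .op .lt 6 5 b.len]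

/-- Append all edges to the input of the copy `j`. -/
def Source.copy (b : Source) (j : ℕ) : Prog :=
  .block [setLinear 3 b.slope₁ b.shift₁, setLinear 4 b.slope₂ b.shift₂, .const 5 0,
    .op .lt 6 5 b.len, .loop 6 (b.copyOne j)]

/-- A source reads the input arrays only. -/
def Source.Valid (b : Source) : Prop := b.fst < 4 ∧ b.snd < 4 ∧ b.len < 3

theorem Inv.copyOne (h : Inv n m F w j N l A B s) {b : Source} (hb : b.Valid)
    (h3 : s.reg 3 = b.slope₁ * n + b.shift₁) (h4 : s.reg 4 = b.slope₂ * n + b.shift₂)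
    {i : ℕ} (h5 : s.reg 5 = i) (hi : i + 1 < 2 ^ w) (he₁ : (b.edge n F i).1 < 2 ^ w)
    (he₂ : (b.edge n F i).2 < 2 ^ w) (hl : l.length + 1 < 2 ^ w) :
    Spec ⟨[b.copyOne j], s⟩ w 19 fun s' => Inv n m F w j N (l ++ [b.edge n F i]) A B s' ∧
      s'.reg 3 = b.slope₁ * n + b.shift₁ ∧ s'.reg 4 = b.slope₂ * n + b.shift₂ ∧
      s'.reg 5 = i + 1 ∧ s'.reg 6 = if i + 1 < regVal n m b.len then 1 else 0 := by
  obtain ⟨hb1, hb2, hb3⟩ := hb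
  have s5 : IsScratch 5 := by unfold IsScratch; omega
  have s6 : IsScratch 6 := by unfold IsScratch; omega
  have s7 : IsScratch 7 := by unfold IsScratch; omega
  have s8 : IsScratch 8 := by unfold IsScratch; omega
  obtain ⟨x, hx⟩ : ∃ x, x = (b.edge n F i).1 := ⟨_, rfl⟩
  obtain ⟨y, hy⟩ : ∃ y, y = (b.edge n F i).2 := ⟨_, rfl⟩
  have exy : b.edge n F i = (x, y) := by rw [hx, hy]
  rw [← hx] at he₁
  rw [← hy] at he₂
  rw [exy]
  -- Before the offset is added, an entry is at most the final endpoint.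
  have f1 : F b.fst i < 2 ^ w := lt_of_le_of_lt (by rw [hx]; exact Nat.le_add_right _ _) he₁
  have f2 : F b.snd i < 2 ^ w := lt_of_le_of_lt (by rw [hy]; exact Nat.le_add_right _ _) he₂
  have i1 := h.setReg s7 f1
  have i2 := i1.setReg s7 he₁
  have i3 := i2.setReg s8 f2
  have i4 := i3.setReg s8 he₂
  have i7 := i4.concat he₁ he₂ hl
  have i8 := i7.setReg s5 hi
  have hc : (if i + 1 < regVal n m b.len then 1 else 0) < 2 ^ w := by
    have := h.one_lt
    split_ifs <;> omega
  have i9 := i8.setReg s6 hc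
  refine Spec.block_cons h.fits (Spec.load h.fits ?_)
  rw [h.src _ hb1, h5]
  refine Spec.block_cons i1.fits (Spec.op i1.fits ?_)
  rw [show Op.add.eval _ _ = x by simp [Op.eval, h3, hx, Source.edge]]
  refine Spec.block_cons i2.fits (Spec.load i2.fits ?_)
  rw [i2.src _ hb2, show ((s.setReg 7 (F b.fst i)).setReg 7 x).reg 5 = i by simp [h5]]
  refine Spec.block_cons i3.fits (Spec.op i3.fits ?_)
  rw [show Op.add.eval _ _ = y by simp [Op.eval, h4, hy, Source.edge]]
  have ec := i4.curReg 1
  simp only [one_ne_zero, if_false, if_true] at ec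
  refine Spec.block_cons i4.fits (Spec.store i4.fits ?_)
  rw [ec, show Store.reg _ 7 = x by simp]
  -- Until both endpoints and the new length are written the invariant fails; `i5` and `i6` carry
  -- only the word bound, and `i7` restores the invariant.
  have i5 := i4.fits.setArr he₁ (slot j 0) l.length
  refine Spec.block_cons i5 (Spec.store i5 ?_)
  simp only [Store.reg_setArr]
  rw [ec, show Store.reg _ 8 = y by simp]
  have i6 := i5.setArr he₂ (slot j 1) l.length
  refine Spec.block_cons i6 (Spec.op i6 ?_)
  simp only [Store.reg_setArr]
  rw [ec, i4.reg2, show Op.add.eval l.length 1 = l.length + 1 from rfl]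
  refine Spec.block_cons i7.fits (Spec.op i7.fits ?_)
  rw [i7.reg2, show Op.add.eval _ _ = i + 1 by simp [Op.eval, h5, ne_slot]]
  refine Spec.block_cons i8.fits (Spec.op i8.fits ?_)
  rw [i8.reg_eq hb3, show Op.lt.eval _ _ = if i + 1 < regVal n m b.len then 1 else 0 by
    simp [Op.eval]]
  refine Spec.block_nil i9.fits (Spec.nil i9.fits ⟨i9, ?_⟩ 0)
  simp [ne_slot, h3, h4]

/-- Here `k` counts the edges still to be copied. A round costs 19 steps for the body and one for
the test. -/
theorem Inv.copyLoop {b : Source} (hb : b.Valid) (k : ℕ) :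
    ∀ {i : ℕ} {l : List (ℕ × ℕ)} {s : Store}, Inv n m F w j N l A B s →
      s.reg 3 = b.slope₁ * n + b.shift₁ → s.reg 4 = b.slope₂ * n + b.shift₂ →
      s.reg 5 = i → s.reg 6 = (if i < regVal n m b.len then 1 else 0) →
      i + k = regVal n m b.len →
      (∀ e ∈ b.edges n m F, e.1 < 2 ^ w ∧ e.2 < 2 ^ w) → l.length + k < 2 ^ w →
      Spec ⟨[.loop 6 (b.copyOne j)], s⟩ w (1 + 20 * k) fun s' =>
        Inv n m F w j N (l ++ (List.range' i k).map (b.edge n F)) A B s' := by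
  induction k with
  | zero =>
    intro i l s h h3 h4 h5 h6 hik he hl
    have : s.reg 6 = 0 := by rw [h6, if_neg (by omega)]
    exact Spec.loop_of_eq_zero h.fits this (Spec.nil h.fits (by simpa using h) 0)
  | succ k ih =>
    intro i l s h h3 h4 h5 h6 hik he hl
    have hi : i < regVal n m b.len := by omega
    have h6' : s.reg 6 ≠ 0 := by rw [h6, if_pos hi]; norm_num
    have hr : regVal n m b.len < 2 ^ w := h.reg_eq hb.2.2 ▸ h.fits.1 _
    have hmem : b.edge n F i ∈ b.edges n m F :=
      List.mem_map.2 ⟨i, List.mem_range.2 hi, rfl⟩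
    have h1 := h.copyOne hb h3 h4 h5 (by omega) (he _ hmem).1 (he _ hmem).2 (by omega)
    have h2 := h1.append (L := [.loop 6 (b.copyOne j)]) fun s' ⟨g, g3, g4, g5, g6⟩ _ =>
      ih g g3 g4 g5 g6 (by omega) he (by simp; omega)
    refine (Spec.loop_of_ne_zero h.fits h6' h2).mono le_rfl (by omega) ?_
    intro s' hs' _
    simpa [List.range'_succ] using hs'

theorem Inv.copy (h : Inv n m F w j N l A B s) (hn : 1 ≤ n) {b : Source} (hb : b.Valid)
    (ho₁ : b.slope₁ * n + b.shift₁ < 2 ^ w) (ho₂ : b.slope₂ * n + b.shift₂ < 2 ^ w)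
    (he : ∀ e ∈ b.edges n m F, e.1 < 2 ^ w ∧ e.2 < 2 ^ w)
    (hl : (l ++ b.edges n m F).length < 2 ^ w) :
    Spec ⟨[b.copy j], s⟩ w (50 * (n + m + 1)) fun s' =>
      Inv n m F w j N (l ++ b.edges n m F) A B s' := by
  have s3 : IsScratch 3 := by unfold IsScratch; omega
  have s4 : IsScratch 4 := by unfold IsScratch; omega
  have s5 : IsScratch 5 := by unfold IsScratch; omega
  have s6 : IsScratch 6 := by unfold IsScratch; omega
  have hlen : (b.edges n m F).length = regVal n m b.len := by simp [Source.edges]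
  have key := Spec.append (K := [WordRAM.setLinear 3 b.slope₁ b.shift₁])
    (T₂ := 17 + 20 * regVal n m b.len)
    (L := [.block [WordRAM.setLinear 4 b.slope₂ b.shift₂, .const 5 0,
      .op .lt 6 5 b.len, .loop 6 (b.copyOne j)]])
    (Q₂ := Inv n m F w j N (l ++ b.edges n m F) A B)
    (h.setLinear hn s3 ho₁) fun s₁ ⟨h₁, h₁3, _⟩ _ => by
      have key := Spec.append (K := [WordRAM.setLinear 4 b.slope₂ b.shift₂])
        (T₂ := 7 + 20 * regVal n m b.len)
        (L := [.block [.const 5 0, .op .lt 6 5 b.len, .loop 6 (b.copyOne j)]])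
        (Q₂ := Inv n m F w j N (l ++ b.edges n m F) A B)
        (h₁.setLinear hn s4 ho₂) fun s₂ ⟨h₂, h₂4, h₂r⟩ _ => by
          have h₂3 := (h₂r 3 (by norm_num) (by norm_num) (by norm_num)).trans h₁3
          have h₃ := h₂.setReg (v := 0) s5 (by positivity)
          have hc : (if 0 < regVal n m b.len then 1 else 0) < 2 ^ w := by
            have := h.one_lt
            split_ifs <;> omega
          have h₄ := h₃.setReg s6 hc
          refine (Spec.block_cons h₂.fits (Spec.const h₂.fits (Spec.block_cons h₃.fits
            (Spec.op h₃.fits (Spec.block_cons (T := 2 + 20 * regVal n m b.len)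
              ?_ ?_))))).mono le_rfl (by omega) fun _ h _ => h
          · rw [h₃.reg_eq hb.2.2]
            simpa [Op.eval] using h₄.fits
          · rw [h₃.reg_eq hb.2.2, show Op.lt.eval _ _ = if 0 < regVal n m b.len then 1 else 0 by
              simp [Op.eval]]
            have := Inv.copyLoop hb (regVal n m b.len) h₄ (i := 0) (by simpa using h₂3)
              (by simpa using h₂4) (by simp) (by simp) (by simp) he (by simpa [hlen] using hl)
            refine (this.append (L := [.block []]) (T₂ := 1) fun s' h' hf =>
              Spec.block_nil hf (Spec.nil hf h' 0)).mono le_rfl (by omega) fun s' h' _ => ?_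
            simpa [Source.edges, List.range_eq_range'] using h'
      exact Spec.mono (T := 1 + (9 + (7 + 20 * regVal n m b.len)))
        ((Spec.block_cons h₁.fits key).mono le_rfl (by omega) fun _ h _ => h) le_rfl (by omega)
        fun _ h _ => h
  -- The total is 27 steps of set-up and final bookkeeping plus 20 per edge, with at most `n + m +
  -- 1` edges.
  have hr := regVal_le n m b.len
  exact (Spec.block_cons h.fits key).mono le_rfl (by omega) fun _ h _ => h

theorem Inv.copyAll (hn : 1 ≤ n) (bs : List Source) :
    ∀ {l : List (ℕ × ℕ)} {s : Store}, Inv n m F w j N l A B s → (∀ b ∈ bs, b.Valid) →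
      (∀ b ∈ bs, b.slope₁ * n + b.shift₁ < 2 ^ w ∧ b.slope₂ * n + b.shift₂ < 2 ^ w) →
      (∀ e ∈ bs.flatMap fun b => b.edges n m F, e.1 < 2 ^ w ∧ e.2 < 2 ^ w) →
      (l ++ bs.flatMap fun b => b.edges n m F).length < 2 ^ w →
      Spec ⟨[.block (bs.map fun b => b.copy j)], s⟩ w (1 + 51 * (n + m + 1) * bs.length) fun s' =>
        Inv n m F w j N (l ++ bs.flatMap fun b => b.edges n m F) A B s' := by
  induction bs with
  | nil =>
    intro l s h _ _ _ _
    exact (Spec.block_nil h.fits (Spec.nil h.fits (by simpa using h) 0))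
  | cons b bs ih =>
    intro l s h hv ho he hl
    simp only [List.flatMap_cons, List.mem_cons, forall_eq_or_imp, List.mem_append] at hv ho he hl
    have h1 := h.copy hn hv.1 ho.1.1 ho.1.2 (fun e h => he e (Or.inl h))
      (by simp only [List.length_append] at hl ⊢; omega)
    refine (Spec.block_cons h.fits (h1.append fun s' h' _ => ih h' hv.2 ho.2
      (fun e h => he e (Or.inr h)) (by simpa [add_assoc] using hl))).mono le_rfl ?_ ?_
    · simp only [List.length_cons]
      nlinarith
    · intro s' h' _
      simpa using h'

end Building

end WordRAM

namespace WordRAM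

/-! ### Running a subprogram on several inputs -/

/-- A task: build a graph with `slope * n + shift` vertices, run the subprogram on it, and add
the result to the first (if `pos`) or the second accumulator. -/
structure Task where
  /-- which accumulator is used -/
  pos : Bool
  /-- the number of vertices is a linear function of `n` -/
  slope : ℕ
  /-- its constant term -/
  shift : ℕ
  /-- where the edges come from -/
  sources : List Source

/-- The number of vertices of the graph. -/
def Task.size (t : Task) (n : ℕ) : ℕ := t.slope * n + t.shift

/-- The edges of the graph. -/
def Task.edges (t : Task) (n m : ℕ) (F : ℕ → ℕ → ℕ) : List (ℕ × ℕ) :=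
  t.sources.flatMap fun b => b.edges n m F

/-- The accumulator of a task. -/
def Task.acc (t : Task) : ℕ := if t.pos then 9 else 10

/-- The program for a task, which uses the copy `j` of the subprogram `P`. -/
def Task.prog (t : Task) (P : Prog) (j : ℕ) : Prog :=
  -- Register `2` holds `1`, so the multiplication serves as a move from register `3`.
  .block [setLinear 3 t.slope t.shift, .op .mul (slot j 0) 3 2,
    .block (t.sources.map fun b => b.copy j), P.rename (slot j) (slot j),
    .op .add t.acc t.acc (slot j 0)]

/-- The program for a list of tasks, which uses the copies `j`, `j + 1`, … of `P`. -/
def tasksProg (P : Prog) : ℕ → List Task → Prog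
  | _, [] => .skip
  | j, t :: ts => .seq (t.prog P j) (tasksProg P (j + 1) ts)

/-- On the graph built by the task `t`, the subprogram returns `r` in time `T`. -/
def Task.Solved (t : Task) (P : Prog) (n m : ℕ) (F : ℕ → ℕ → ℕ) (w r T : ℕ) : Prop :=
  (∀ b ∈ t.sources, b.Valid ∧ b.slope₁ * n + b.shift₁ < 2 ^ w ∧
    b.slope₂ * n + b.shift₂ < 2 ^ w) ∧
  ∃ es : List (Fin (t.size n) × Fin (t.size n)),
    es.map (fun p => ((p.1 : ℕ), (p.2 : ℕ))) = t.edges n m F ∧ Computes P w (t.size n) es r T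

section Tasks

variable {n m : ℕ} {F : ℕ → ℕ → ℕ} {w j N : ℕ} {l : List (ℕ × ℕ)} {A B : ℕ} {s : Store}

theorem Inv.setSize (h : Inv n m F w j N l A B s) {v : ℕ} (hv : v < 2 ^ w) :
    Inv n m F w j v l A B (s.setReg (slot j 0) v) where
  fits := h.fits.setReg hv _
  reg0 := by simp [ne_slot, h.reg0]
  reg1 := by simp [ne_slot, h.reg1]
  reg2 := by simp [ne_slot, h.reg2]
  reg9 := by simp [ne_slot, h.reg9]
  reg10 := by simp [ne_slot, h.reg10]
  src := h.src
  curReg x := by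
    by_cases hx : x = 0
    · simp [hx]
    · simp [hx, slot_inj, h.curReg]
  curArr := h.curArr
  freshReg j' hj x := by simp [slot_inj, hj.ne', h.freshReg j' hj]
  freshArr := h.freshArr

theorem Inv.setAcc (h : Inv n m F w j N l A B s) {v : ℕ} (hv : v < 2 ^ w) (pos : Bool) :
    Inv n m F w j N l (if pos then v else A) (if pos then B else v)
      (s.setReg (if pos then 9 else 10) v) where
  fits := h.fits.setReg hv _
  reg0 := by cases pos <;> simp [h.reg0]
  reg1 := by cases pos <;> simp [h.reg1]
  reg2 := by cases pos <;> simp [h.reg2]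
  reg9 := by cases pos <;> simp [h.reg9]
  reg10 := by cases pos <;> simp [h.reg10]
  src := h.src
  curReg x := by cases pos <;> simp [slot_ne, h.curReg]
  curArr := h.curArr
  freshReg j' hj x := by cases pos <;> simp [slot_ne, h.freshReg j' hj]
  freshArr := h.freshArr

theorem Store.lift_reg_of_lt {k : ℕ} (hk : k < 12) (s₁ : Store) :
    (s₁.lift (slot j) (slot j) s).reg k = s.reg k :=
  Function.extend_apply' _ _ _ fun ⟨x, hx⟩ => slot_ne hk j x hx

theorem Store.lift_arr_of_lt {k : ℕ} (hk : k < 12) (s₁ : Store) :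
    (s₁.lift (slot j) (slot j) s).arr k = s.arr k :=
  Function.extend_apply' _ _ _ fun ⟨x, hx⟩ => slot_ne hk j x hx

theorem Store.lift_reg_of_ne {j' : ℕ} (hj : j ≠ j') (x : ℕ) (s₁ : Store) :
    (s₁.lift (slot j) (slot j) s).reg (slot j' x) = s.reg (slot j' x) :=
  Function.extend_apply' _ _ _ fun ⟨_, hx⟩ => hj (slot_inj.1 hx).1

theorem Store.lift_arr_of_ne {j' : ℕ} (hj : j ≠ j') (x : ℕ) (s₁ : Store) :
    (s₁.lift (slot j) (slot j) s).arr (slot j' x) = s.arr (slot j' x) :=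
  Function.extend_apply' _ _ _ fun ⟨_, hx⟩ => hj (slot_inj.1 hx).1

/-- After the copy `j` of the subprogram, the main program continues with the copy `j + 1`. -/
theorem Inv.lift (h : Inv n m F w j N l A B s) (s₁ : Store)
    (hf : (s₁.lift (slot j) (slot j) s).FitsIn w) :
    Inv n m F w (j + 1) 0 [] A B (s₁.lift (slot j) (slot j) s) where
  fits := hf
  reg0 := by rw [Store.lift_reg_of_lt (by norm_num), h.reg0]
  reg1 := by rw [Store.lift_reg_of_lt (by norm_num), h.reg1]
  reg2 := by rw [Store.lift_reg_of_lt (by norm_num), h.reg2]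
  reg9 := by rw [Store.lift_reg_of_lt (by norm_num), h.reg9]
  reg10 := by rw [Store.lift_reg_of_lt (by norm_num), h.reg10]
  src a ha := by rw [Store.lift_arr_of_lt (by omega), h.src a ha]
  curReg x := by
    rw [Store.lift_reg_of_ne (by omega), h.freshReg _ (by omega)]
    simp
  curArr a i := by
    rw [Store.lift_arr_of_ne (by omega), h.freshArr _ (by omega)]
    simp
  freshReg j' hj x := by rw [Store.lift_reg_of_ne (by omega), h.freshReg _ (by omega)]
  freshArr j' hj a i := by rw [Store.lift_arr_of_ne (by omega), h.freshArr _ (by omega)]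

theorem Computes.spec {P : Prog} {w n : ℕ} {es : List (Fin n × Fin n)} {r T : ℕ}
    (h : Computes P w n es r T) : Spec (init P n es) w T fun s => s.reg 0 = r :=
  ⟨h.1, h.2.1, h.2.2⟩

theorem Computes.fitsIn {P : Prog} {w n : ℕ} {es : List (Fin n × Fin n)} {r : ℕ} {T : ENNReal}
    (h : Computes P w n es r T) : (inputStore n es).FitsIn w :=
  h.1 0 _ (self_mem_support_run _)

/-- The invariant says that the cells of copy `j` form exactly the initial memory of `P` on `es`. So
`s` is the lift of that memory over `s` itself, and `Spec.rename` applies. -/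
theorem Inv.run {P : Prog} {es : List (Fin N × Fin N)} {r T : ℕ}
    (h : Inv n m F w j N (es.map fun p => ((p.1 : ℕ), (p.2 : ℕ))) A B s)
    (hP : Computes P w N es r T) :
    Spec ⟨[P.rename (slot j) (slot j)], s⟩ w T fun s' =>
      Inv n m F w (j + 1) 0 [] A B s' ∧ s'.reg (slot j 0) = r := by
  have hs : s = (inputStore N es).lift (slot j) (slot j) s := by
    have h1 : s.reg = Function.extend (slot j) (inputStore N es).reg s.reg := by
      funext x
      by_cases hx : ∃ z, slot j z = x
      · obtain ⟨z, rfl⟩ := hx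
        rw [(slot_injective j).extend_apply, h.curReg]
        simp [inputStore]
      · rw [Function.extend_apply' _ _ _ hx]
    have h2 : s.arr = Function.extend (slot j) (inputStore N es).arr s.arr := by
      funext x
      by_cases hx : ∃ z, slot j z = x
      · obtain ⟨z, rfl⟩ := hx
        funext i
        rw [(slot_injective j).extend_apply, h.curArr]
        simp [inputStore, Function.comp_def]
      · rw [Function.extend_apply' _ _ _ hx]
    unfold Store.lift
    rw [← h1, ← h2]
  have key := hP.spec.rename (slot_injective j) (slot_injective j) s h.fits
  have e : Config.lift (slot j) (slot j) s (init P N es) =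
      ⟨[P.rename (slot j) (slot j)], s⟩ := by
    unfold Config.lift init
    simp only [List.map_cons, List.map_nil]
    rw [← hs]
  rw [e] at key
  refine key.mono le_rfl le_rfl ?_
  rintro _ ⟨s₁, hr, rfl⟩ hf
  exact ⟨h.lift s₁ hf, ((slot_injective j).extend_apply _ _ _).trans hr⟩

theorem Inv.task (h : Inv n m F w j 0 [] A B s) (hn : 1 ≤ n) {t : Task} {P : Prog} {r T : ℕ}
    (ht : t.Solved P n m F w r T) {A' B' : ℕ} (hA : A' = A + if t.pos then r else 0)
    (hB : B' = B + if t.pos then 0 else r) (hA' : A' < 2 ^ w) (hB' : B' < 2 ^ w) :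
    Spec ⟨[t.prog P j], s⟩ w (20 + 51 * (n + m + 1) * t.sources.length + T) fun s' =>
      Inv n m F w (j + 1) 0 [] A' B' s' := by
  obtain ⟨hsrc, es, hes, hP⟩ := ht
  -- The word bound for `P` at time zero covers its input, and thereby everything written while
  -- building it.
  have hN : t.size n < 2 ^ w := by simpa [inputStore] using hP.fitsIn.1 0
  have hl : es.length < 2 ^ w := by simpa [inputStore] using hP.fitsIn.1 1
  have s3 : IsScratch 3 := by unfold IsScratch; omega
  have key := (h.setLinear hn s3 hN).append (T₂ := 9 + 51 * (n + m + 1) * t.sources.length + T)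
    (L := [.block [.op .mul (slot j 0) 3 2,
      .block (t.sources.map fun b => b.copy j), P.rename (slot j) (slot j),
      .op .add t.acc t.acc (slot j 0)]]) (Q₂ := Inv n m F w (j + 1) 0 [] A' B')
    fun s₁ ⟨h₁, h₁3, _⟩ _ => by
      have h₂ := h₁.setSize hN
      have hcopy := Inv.copyAll hn t.sources h₂ (fun b hb => (hsrc b hb).1)
        (fun b hb => (hsrc b hb).2) (by
          change ∀ e ∈ t.edges n m F, _
          rw [← hes]
          intro e he
          obtain ⟨p, _, rfl⟩ := List.mem_map.1 he
          exact ⟨p.1.2.trans hN, p.2.2.trans hN⟩)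
        (by
          change ([] ++ t.edges n m F).length < _
          simpa [← hes] using hl)
      have key := hcopy.append
        (L := [.block [P.rename (slot j) (slot j), .op .add t.acc t.acc (slot j 0)]])
        (T₂ := 4 + T) (Q₂ := Inv n m F w (j + 1) 0 [] A' B') fun s₃ h₃ _ => by
          rw [List.nil_append] at h₃
          change Inv n m F w j _ (t.edges n m F) A B s₃ at h₃
          rw [← hes] at h₃
          have key := (h₃.run hP).append (L := [.block [.op .add t.acc t.acc (slot j 0)]])
            (T₂ := 3) (Q₂ := Inv n m F w (j + 1) 0 [] A' B') fun s₄ ⟨h₄, h₄r⟩ _ => by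
              have h₅ : Inv n m F w (j + 1) 0 [] A' B' (s₄.setReg t.acc
                  (Op.add.eval (s₄.reg t.acc) (s₄.reg (slot j 0)))) := by
                cases hp : t.pos
                · have := h₄.setAcc (v := B') hB' false
                  simp only [hp, Bool.false_eq_true, if_false, add_zero] at hA hB this
                  simpa [Task.acc, hp, Op.eval, h₄r, h₄.reg10, ← hB, hA] using this
                · have := h₄.setAcc (v := A') hA' true
                  simp only [hp, if_true, add_zero] at hA hB this
                  simpa [Task.acc, hp, Op.eval, h₄r, h₄.reg9, ← hA, hB] using this
              exact Spec.block_cons h₄.fits (Spec.op h₄.fits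
                (Spec.block_nil h₅.fits (Spec.nil h₅.fits h₅ 0)))
          exact (Spec.block_cons h₃.fits key).mono le_rfl (by omega) fun _ h _ => h
      refine Spec.mono (T := 1 + 51 * (n + m + 1) * t.sources.length + (4 + T) + 1 + 1 + 1)
        (Spec.block_cons h₁.fits (Spec.op h₁.fits ?_)) le_rfl (by omega) fun _ h _ => h
      rw [h₁3, h₁.reg2, show Op.mul.eval (t.slope * n + t.shift) 1 = t.size n by
        simp [Op.eval, Task.size]]
      exact Spec.block_cons h₂.fits key
  exact (Spec.block_cons h.fits key).mono le_rfl (by omega) fun _ h _ => h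

/-- Each task has a fresh copy of the subprogram's memory, so nothing needs clearing in between. -/
theorem Inv.tasks (hn : 1 ≤ n) {P : Prog} {ι : Type*} {task : ι → Task} {r : ι → ℕ} {D T : ℕ}
    (ts : List ι) :
    ∀ {j A B : ℕ} {s : Store}, Inv n m F w j 0 [] A B s →
      (∀ t ∈ ts, (task t).Solved P n m F w (r t) T ∧ (task t).sources.length ≤ D) →
      A + (ts.map fun t => if (task t).pos then r t else 0).sum < 2 ^ w →
      B + (ts.map fun t => if (task t).pos then 0 else r t).sum < 2 ^ w →
      Spec ⟨[tasksProg P j (ts.map task)], s⟩ w (1 + ts.length * (21 + 51 * (n + m + 1) * D + T)) fun s' =>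
        Inv n m F w (j + ts.length) 0 [] (A + (ts.map fun t => if (task t).pos then r t else 0).sum)
          (B + (ts.map fun t => if (task t).pos then 0 else r t).sum) s' := by
  induction ts with
  | nil =>
    intro j A B s h _ _ _
    simpa [tasksProg] using Spec.skip h.fits (Spec.nil h.fits h 0)
  | cons t ts ih =>
    intro j A B s h ht hA hB
    simp only [List.map_cons, List.sum_cons, List.mem_cons, forall_eq_or_imp] at hA hB ht ⊢
    have h1 := h.task hn ht.1.1 rfl rfl (by omega) (by omega)
    have h2 := h1.append fun s' h' _ => ih h' ht.2 (by omega) (by omega)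
    refine (Spec.seq h.fits h2).mono le_rfl ?_ ?_
    · have : 51 * (n + m + 1) * (task t).sources.length ≤ 51 * (n + m + 1) * D :=
        Nat.mul_le_mul_left _ ht.1.2
      simp only [List.length_cons, add_mul, one_mul]
      omega
    · intro s' h' _
      simpa [add_assoc, add_comm, add_left_comm] using h'

end Tasks

/-! ### The main program -/

/-- The arrays from which edges are copied: the endpoints of the edges of the input, an array of
zeros, and the list of all numbers below `k`. -/
def sourceArr {n : ℕ} (es : List (Fin n × Fin n)) (k a i : ℕ) : ℕ :=
  if a = 0 then (es.map fun p => (p.1 : ℕ)).getD i 0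
  else if a = 1 then (es.map fun p => (p.2 : ℕ)).getD i 0
  else if a = 3 then if i < k then i else 0
  else 0

/-- Write one number into the array `3`. -/
def fillOne : Prog := .block [.store 3 5 5, .op .add 5 5 2, .op .lt 6 5 0]

/-- Run the subprogram on all tasks, subtract the second accumulator from the first one, and divide
the result by `d`. -/
def mainProg (P : Prog) (ts : List Task) (d : ℕ) : Prog :=
  .block [.const 2 1, .const 5 0, .op .lt 6 5 0, .loop 6 fillOne, tasksProg P 0 ts,
    .op .sub 0 9 10, .const 11 d, .op .div 0 0 11]

section Main

variable {n w : ℕ} {es : List (Fin n × Fin n)}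

/-- Writing `k` into cell `k` of array `3` turns `sourceArr es k` into `sourceArr es (k + 1)`; `c`
rounds remain. -/
theorem Inv.fillLoop {m j N : ℕ} {l : List (ℕ × ℕ)} {A B : ℕ} (c : ℕ) :
    ∀ {k : ℕ} {s : Store}, Inv n m (sourceArr es k) w j N l A B s → s.reg 5 = k →
      s.reg 6 = (if k < n then 1 else 0) → k + c = n →
      Spec ⟨[.loop 6 fillOne], s⟩ w (1 + 8 * c) (Inv n m (sourceArr es n) w j N l A B) := by
  induction c with
  | zero =>
    intro k s h h5 h6 hk
    obtain rfl : k = n := by omega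
    have : s.reg 6 = 0 := by simp [h6]
    exact Spec.loop_of_eq_zero h.fits this (Spec.nil h.fits h 0)
  | succ c ih =>
    intro k s h h5 h6 hk
    have hkn : k < n := by omega
    have h6' : s.reg 6 ≠ 0 := by rw [h6, if_pos hkn]; norm_num
    have hn : n < 2 ^ w := h.reg0 ▸ h.fits.1 0
    have s5 : IsScratch 5 := by unfold IsScratch; omega
    have s6 : IsScratch 6 := by unfold IsScratch; omega
    have h1 : Inv n m (sourceArr es (k + 1)) w j N l A B (s.setArr 3 k k) :=
      { fits := h.fits.setArr (by omega) _ _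
        reg0 := h.reg0
        reg1 := h.reg1
        reg2 := h.reg2
        reg9 := h.reg9
        reg10 := h.reg10
        src := fun a ha => by
          funext i
          rw [Store.arr_setArr, h.src a ha]
          by_cases h3 : a = 3
          · subst h3
            simp only [sourceArr, true_and]
            norm_num
            split_ifs <;> omega
          · simp [sourceArr, h3]
        curReg := h.curReg
        curArr := fun a i => by simp [slot_ne, h.curArr]
        freshReg := h.freshReg
        freshArr := fun j' hj a i => by simp [slot_ne, h.freshArr j' hj] }
    have h2 := h1.setReg s5 (v := k + 1) (by omega)
    have hc : (if k + 1 < n then 1 else 0) < 2 ^ w := by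
      have := h.one_lt
      split_ifs <;> omega
    have h3 := h2.setReg s6 hc
    have hstep : Spec ⟨[fillOne], s⟩ w 7 fun s' =>
        Inv n m (sourceArr es (k + 1)) w j N l A B s' ∧ s'.reg 5 = k + 1 ∧
          s'.reg 6 = if k + 1 < n then 1 else 0 := by
      refine Spec.block_cons h.fits (Spec.store h.fits ?_)
      rw [h5]
      refine Spec.block_cons h1.fits (Spec.op h1.fits ?_)
      rw [h1.reg2, show Op.add.eval _ _ = k + 1 by simp [Op.eval, h5]]
      refine Spec.block_cons h2.fits (Spec.op h2.fits ?_)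
      rw [h2.reg0, show Op.lt.eval _ _ = if k + 1 < n then 1 else 0 by simp [Op.eval]]
      exact Spec.block_nil h3.fits (Spec.nil h3.fits ⟨h3, by simp, by simp⟩ 0)
    have h4 := hstep.append (L := [.loop 6 fillOne]) fun s' ⟨g, g5, g6⟩ _ =>
      ih g g5 g6 (by omega)
    exact (Spec.loop_of_ne_zero h.fits h6' h4).mono le_rfl (by omega) fun _ h _ => h

/-- Separate accumulators for the two signs keep all words non-negative. The subtraction is
truncated here; that it is exact for the tasks in question is part of `sum_subsetList`. -/
theorem computes_mainProg (hn : 1 ≤ n) {P : Prog} {ι : Type*} {task : ι → Task} {ts : List ι}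
    {r : ι → ℕ} {d D T : ℕ}
    (hfit : (inputStore n es).FitsIn w) (hw : 1 < 2 ^ w) (hd : d < 2 ^ w)
    (hts : ∀ t ∈ ts, (task t).Solved P n es.length (sourceArr es n) w (r t) T ∧
      (task t).sources.length ≤ D)
    (hA : (ts.map fun t => if (task t).pos then r t else 0).sum < 2 ^ w)
    (hB : (ts.map fun t => if (task t).pos then 0 else r t).sum < 2 ^ w) :
    Computes (mainProg P (ts.map task) d) w n es
      (((ts.map fun t => if (task t).pos then r t else 0).sum -
        (ts.map fun t => if (task t).pos then 0 else r t).sum) / d)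
      ((18 + 8 * n + ts.length * (21 + 51 * (n + es.length + 1) * D + T) : ℕ) : ENNReal) := by
  set RA := (ts.map fun t => if (task t).pos then r t else 0).sum with hRA
  set RB := (ts.map fun t => if (task t).pos then 0 else r t).sum with hRB
  have s5 : IsScratch 5 := by unfold IsScratch; omega
  have s6 : IsScratch 6 := by unfold IsScratch; omega
  have s11 : IsScratch 11 := by unfold IsScratch; omega
  have h1 : Inv n es.length (sourceArr es 0) w 0 0 [] 0 0 ((inputStore n es).setReg 2 1) :=
    { fits := hfit.setReg hw _
      reg0 := by simp [inputStore]
      reg1 := by simp [inputStore]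
      reg2 := by simp
      reg9 := by simp [inputStore]
      reg10 := by simp [inputStore]
      src := fun a _ => by
        funext i
        simp [inputStore, sourceArr]
      curReg := fun x => by simp [inputStore, slot_ne]
      curArr := fun a i => by simp [inputStore, slot_ne]
      freshReg := fun j' _ x => by simp [inputStore, slot_ne]
      freshArr := fun j' _ a i => by simp [inputStore, slot_ne] }
  have h2 := h1.setReg s5 (v := 0) (by positivity)
  have h3 := h2.setReg s6 hw
  have key := (h3.fillLoop n (k := 0) (by simp) (by simp [Nat.pos_of_ne_zero (by omega : n ≠ 0)])
    (by simp)).append (L := [.block [tasksProg P 0 (ts.map task), .op .sub 0 9 10, .const 11 d,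
      .op .div 0 0 11]])
    (T₂ := 9 + ts.length * (21 + 51 * (n + es.length + 1) * D + T))
    (Q₂ := fun s => s.reg 0 = (RA - RB) / d) fun s₄ h₄ _ => by
      have key := (h₄.tasks hn ts hts (by simpa using hA) (by simpa using hB)).append
        (L := [.block [.op .sub 0 9 10, .const 11 d, .op .div 0 0 11]])
        (T₂ := 7) (Q₂ := fun s => s.reg 0 = (RA - RB) / d) fun s₅ h₅ f₅ => by
          have hsub : RA - RB < 2 ^ w := (Nat.sub_le _ _).trans_lt hA
          have f₆ := f₅.setReg hsub 0
          have f₇ := f₆.setReg hd 11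
          have f₈ := f₇.setReg ((Nat.div_le_self (RA - RB) d).trans_lt hsub) 0
          refine Spec.block_cons f₅ (Spec.op f₅ ?_)
          rw [h₅.reg9, h₅.reg10, zero_add, zero_add, ← hRA, ← hRB,
            show Op.sub.eval RA RB = RA - RB from rfl]
          refine Spec.block_cons f₆ (Spec.const f₆ ?_)
          refine Spec.block_cons f₇ (Spec.op f₇ ?_)
          rw [show Op.div.eval _ _ = (RA - RB) / d by simp [Op.eval]]
          exact Spec.block_nil f₈ (Spec.nil f₈ (by simp) 0)
      exact (Spec.block_cons h₄.fits key).mono le_rfl (by omega) fun _ h _ => h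
  have main : Spec (init (mainProg P (ts.map task) d) n es) w
      (18 + 8 * n + ts.length * (21 + 51 * (n + es.length + 1) * D + T))
      fun s => s.reg 0 = (RA - RB) / d := by
    refine (Spec.block_cons hfit (Spec.const hfit (Spec.block_cons h1.fits (Spec.const h1.fits
      (Spec.block_cons h2.fits (Spec.op h2.fits (T := 1 + 8 * n + (9 + ts.length *
        (21 + 51 * (n + es.length + 1) * D + T)) + 1) ?_)))))).mono le_rfl (by omega)
      fun _ h _ => h
    rw [h2.reg0, show Op.lt.eval _ n = 1 by simp [Op.eval]; omega]
    exact Spec.block_cons h3.fits key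
  exact ⟨main.fits, main.post, main.time⟩

end Main

end WordRAM

/-! ### The blow-up of `H` along `S` -/

open Classical in
/-- The size of the fiber of a vertex in the blow-up. -/
noncomputable def fiberSize {V : Type*} (S : Set V) (n : ℕ) (v : V) : ℕ := if v ∈ S then n else 1

/-- The adjacency relation of `G` on the numbers of the vertices. -/
def natAdj {n : ℕ} (G : SimpleGraph (Fin n)) (p q : ℕ) : Prop :=
  ∃ a b, G.Adj a b ∧ (a : ℕ) = p ∧ (b : ℕ) = q

theorem natAdj.symm {n : ℕ} {G : SimpleGraph (Fin n)} {p q : ℕ} (h : natAdj G p q) :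
    natAdj G q p :=
  let ⟨a, b, hab, ha, hb⟩ := h
  ⟨b, a, hab.symm, hb, ha⟩

/-- The graph whose vertices are the pairs of a vertex `v` of `H` and a vertex of `G` if `v ∈ S`
and of a single point otherwise. -/
def blowup {V : Type*} (H : SimpleGraph V) (S : Set V) {n : ℕ} (G : SimpleGraph (Fin n)) :
    SimpleGraph (Σ v : V, Fin (fiberSize S n v)) where
  Adj x y := H.Adj x.1 y.1 ∧ (x.1 ∈ S → y.1 ∈ S → natAdj G x.2 y.2)
  symm := ⟨fun _ _ h => ⟨h.1.symm, fun hy hx => (h.2 hx hy).symm⟩⟩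
  loopless := ⟨fun _ h => h.1.ne rfl⟩

theorem fiberSize_of_mem {V : Type*} {S : Set V} {v : V} (h : v ∈ S) (n : ℕ) :
    fiberSize S n v = n := if_pos h

theorem fiberSize_of_notMem {V : Type*} {S : Set V} {v : V} (h : v ∉ S) (n : ℕ) :
    fiberSize S n v = 1 := if_neg h

theorem snd_lt_of_mem {V : Type*} {S : Set V} {n : ℕ} {x : Σ v : V, Fin (fiberSize S n v)}
    (hx : x.1 ∈ S) : (x.2 : ℕ) < n := x.2.2.trans_eq (fiberSize_of_mem hx n)

theorem snd_eq_zero_of_notMem {V : Type*} {S : Set V} {n : ℕ}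
    {x : Σ v : V, Fin (fiberSize S n v)} (hx : x.1 ∉ S) : (x.2 : ℕ) = 0 :=
  Nat.lt_one_iff.1 (x.2.2.trans_eq (fiberSize_of_notMem hx n))

/-! ### Counting homomorphisms into the blow-up -/

instance {V W : Type*} [Finite V] [Finite W] (H : SimpleGraph V) (G : SimpleGraph W) :
    Finite (H →g G) := DFunLike.finite _

/-- Homomorphisms to an induced subgraph. -/
theorem homCount_comap {V W W' : Type*} (H : SimpleGraph V) (G : SimpleGraph W) {f : W' → W}
    (hf : f.Injective) :
    homCount H (G.comap f) = Nat.card {φ : H →g G // ∀ v, φ v ∈ Set.range f} := by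
  refine Nat.card_congr
    { toFun := fun φ => ⟨⟨f ∘ φ, fun h => φ.map_rel h⟩, fun v => ⟨φ v, rfl⟩⟩
      invFun := fun φ => ⟨fun v => (φ.2 v).choose, fun {a b} h => ?_⟩
      left_inv := fun φ => ?_
      right_inv := fun φ => ?_ }
  · change G.Adj (f (φ.2 a).choose) (f (φ.2 b).choose)
    rw [(φ.2 a).choose_spec, (φ.2 b).choose_spec]
    exact φ.1.map_rel h
  · ext v
    have : ∃ y, f y = f (φ v) := ⟨φ v, rfl⟩
    exact hf this.choose_spec
  · apply Subtype.ext
    ext v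
    exact (φ.2 v).choose_spec

/-- Inclusion and exclusion for the objects that are not supported on a proper subset. -/
theorem sum_neg_one_pow_mul_card {V Φ : Type*} [Fintype V] [DecidableEq V] [Fintype Φ]
    (c : Φ → Finset V) :
    ∑ T : Finset V, (-1 : ℤ) ^ Tᶜ.card * (Nat.card {φ // c φ ⊆ T} : ℤ) =
      Nat.card {φ // c φ = Finset.univ} := by
  classical
  have h1 : ∀ T : Finset V, (Nat.card {φ // c φ ⊆ T} : ℤ) = ∑ φ, if c φ ⊆ T then 1 else 0 := by
    intro T
    simp [Nat.card_eq_fintype_card, Fintype.card_subtype]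
  have h2 : (Nat.card {φ // c φ = Finset.univ} : ℤ) =
      ∑ φ, if c φ = Finset.univ then 1 else 0 := by
    simp [Nat.card_eq_fintype_card, Fintype.card_subtype]
  simp_rw [h1, h2, Finset.mul_sum]
  rw [Finset.sum_comm]
  refine Finset.sum_congr rfl fun φ _ => ?_
  -- For fixed `φ`, complementation turns the sets `T ⊇ c φ` into the subsets of `(c φ)ᶜ`, whose
  -- alternating sum vanishes unless `(c φ)ᶜ` is empty.
  have h3 := Finset.sum_powerset_neg_one_pow_card (x := (c φ)ᶜ)
  simp only [Finset.compl_eq_empty_iff] at h3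
  rw [← h3]
  simp only [mul_ite, mul_one, mul_zero]
  rw [← Finset.sum_filter]
  refine Finset.sum_nbij' (fun T => Tᶜ) (fun T => Tᶜ) ?_ ?_ ?_ ?_ ?_
  · simp
  · intro U hU
    simpa [Finset.subset_compl_comm] using hU
  all_goals simp

section Blowup

variable {V : Type*} [Finite V] (H : SimpleGraph V) (S : Set V) {n : ℕ} (G : SimpleGraph (Fin n))

/-- The projection of the blow-up. -/
def blowupProj : blowup H S G →g H := ⟨Sigma.fst, fun h => h.1⟩

/-- A bijective endomorphism of a finite graph is an automorphism. -/
noncomputable def autOfBijective {H : SimpleGraph V} (σ : H →g H) (hσ : Function.Bijective σ) :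
    H ≃g H where
  toEquiv := Equiv.ofBijective σ hσ
  map_rel_iff' := by
    intro a b
    set e : Equiv.Perm V := Equiv.ofBijective σ hσ with he
    have hom : ∀ x y, H.Adj x y → H.Adj (e x) (e y) := fun x y h => σ.map_rel h
    -- The permutation `e` has finite order, so its inverse is one of its powers and preserves
    -- adjacency too.
    have hpow : ∀ (k : ℕ) (x y), H.Adj x y → H.Adj ((e ^ k) x) ((e ^ k) y) := by
      intro k
      induction k with
      | zero => intro x y h; simpa using h
      | succ k ih =>
        intro x y h
        rw [pow_succ', Equiv.Perm.mul_apply, Equiv.Perm.mul_apply]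
        exact hom _ _ (ih x y h)
    refine ⟨fun h => ?_, hom a b⟩
    have h0 : 0 < orderOf e := orderOf_pos e
    have h1 := hpow (orderOf e - 1) _ _ h
    have h2 : e ^ (orderOf e - 1) * e = 1 := by
      rw [← pow_succ, Nat.sub_add_cancel h0, pow_orderOf_eq_one]
    rwa [← Equiv.Perm.mul_apply, ← Equiv.Perm.mul_apply, h2] at h1

/-- The homomorphisms to the blow-up that project onto `H` are the sections, up to automorphisms. -/
theorem card_surjective_hom :
    Nat.card {φ : H →g blowup H S G // Function.Surjective fun v => (φ v).1} =
      Nat.card (H ≃g H) * Nat.card {ψ : H →g blowup H S G // ∀ v, (ψ v).1 = v} := by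
  rw [← Nat.card_prod]
  -- The projection of `φ` is thus an automorphism; precomposing `φ` with its inverse gives the
  -- section.
  have hbij : ∀ φ : {φ : H →g blowup H S G // Function.Surjective fun v => (φ v).1},
      Function.Bijective ((blowupProj H S G).comp φ.1) := fun φ =>
    (Finite.surjective_iff_bijective).1 φ.2
  refine Nat.card_congr
    { toFun := fun φ => ⟨autOfBijective _ (hbij φ),
        ⟨φ.1.comp (autOfBijective _ (hbij φ)).symm.toHom, fun v =>
          (autOfBijective _ (hbij φ)).apply_symm_apply v⟩⟩
      invFun := fun p => ⟨p.2.1.comp p.1.toHom, fun v => ⟨p.1.symm v, ?_⟩⟩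
      left_inv := fun φ => ?_
      right_inv := fun p => ?_ }
  · change (p.2.1 (p.1 (p.1.symm v))).1 = v
    rw [p.2.2, RelIso.apply_symm_apply]
  · apply Subtype.ext
    ext1 v
    change φ.1 ((autOfBijective _ (hbij φ)).symm ((autOfBijective _ (hbij φ)) v)) = φ.1 v
    rw [RelIso.symm_apply_apply]
  · have h : ∀ hb, autOfBijective ((blowupProj H S G).comp (p.2.1.comp p.1.toHom)) hb = p.1 := by
      intro hb
      ext v
      exact p.2.2 (p.1 v)
    refine Prod.ext (h _) (Subtype.ext ?_)
    ext1 v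
    change p.2.1 (p.1 ((autOfBijective _ _).symm v)) = p.2.1 v
    rw [h, RelIso.apply_symm_apply]

-- A section chooses a vertex of `G` for each `v ∈ S` and has no choice elsewhere. An edge of `H`
-- constrains these choices only when both its ends lie in `S`.
omit [Finite V] in
theorem card_section :
    Nat.card {ψ : H →g blowup H S G // ∀ v, (ψ v).1 = v} = homCount (H.induce S) G := by
  classical
  have hlt : ∀ (ψ : {ψ : H →g blowup H S G // ∀ v, (ψ v).1 = v}) (v : S), ((ψ.1 v).2 : ℕ) < n :=
    fun ψ v => snd_lt_of_mem ((ψ.2 v).symm ▸ v.2)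
  refine Nat.card_congr
    { toFun := fun ψ => ⟨fun v => ⟨(ψ.1 v).2, hlt ψ v⟩, fun {a b} h => ?_⟩
      invFun := fun χ => ⟨⟨fun v => ⟨v, if h : v ∈ S then ⟨χ ⟨v, h⟩, ?_⟩ else ⟨0, ?_⟩⟩,
        fun {a b} h => ⟨h, fun ha hb => ?_⟩⟩, fun v => rfl⟩
      left_inv := fun ψ => ?_
      right_inv := fun χ => ?_ }
  · have h1 := (ψ.1.map_rel (show H.Adj a b from h)).2 ((ψ.2 a).symm ▸ a.2) ((ψ.2 b).symm ▸ b.2)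
    obtain ⟨x, y, hxy, hx, hy⟩ := h1
    convert hxy using 1
    · exact Fin.ext hx.symm
    · exact Fin.ext hy.symm
  · rw [fiberSize_of_mem h]
    exact (χ ⟨v, h⟩).2
  · rw [fiberSize_of_notMem h]
    exact one_pos
  · have ha' : a ∈ S := ha
    have hb' : b ∈ S := hb
    simp only [ha', hb', dif_pos]
    exact ⟨_, _, χ.map_rel (show (H.induce S).Adj ⟨a, ha⟩ ⟨b, hb⟩ from h), rfl, rfl⟩
  · apply Subtype.ext
    ext1 v
    have key : ∀ x : Σ v, Fin (fiberSize S n v), x.1 = v →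
        ∀ y : Fin (fiberSize S n v), (y : ℕ) = x.2 → (⟨v, y⟩ : Σ v, Fin (fiberSize S n v)) = x := by
      rintro ⟨_, x⟩ rfl y hy
      exact congrArg _ (Fin.ext hy)
    refine key _ (ψ.2 v) _ ?_
    split_ifs with h
    · rfl
    · exact (snd_eq_zero_of_notMem (by rwa [ψ.2 v])).symm
  · ext v
    change ((if h : (v : V) ∈ S then ⟨χ ⟨v, h⟩, _⟩ else ⟨0, _⟩ : Fin (fiberSize S n v)) : ℕ) = χ v
    rw [dif_pos v.2]

/-- The number of homomorphisms from an induced subgraph in terms of those from the whole graph. -/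
theorem sum_homCount_blowup [Fintype V] [DecidableEq V] :
    ∑ T : Finset V, (-1 : ℤ) ^ Tᶜ.card * (Nat.card {φ : H →g blowup H S G // ∀ v, (φ v).1 ∈ T} : ℤ) =
      (Nat.card (H ≃g H) * homCount (H.induce S) G : ℕ) := by
  have := Fintype.ofFinite (H →g blowup H S G)
  -- Each `φ` is classified by the set of fibers that it meets.
  have key := sum_neg_one_pow_mul_card
    fun φ : H →g blowup H S G => Finset.univ.image fun v => (φ v).1
  simp only [Finset.image_subset_iff, Finset.mem_univ, true_imp_iff] at key
  rw [key, ← card_section, ← card_surjective_hom]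
  congr 1
  refine Nat.card_congr (Equiv.subtypeEquivRight fun φ => ?_)
  simp [Finset.eq_univ_iff_forall, Function.Surjective]

end Blowup

/-! ### Degeneracy -/

theorem IsDegenerate.comap {V W : Type*} [Finite V] [Finite W] {G : SimpleGraph W} {κ : ℕ}
    (h : IsDegenerate G κ) {f : V → W} (hf : f.Injective) : IsDegenerate (G.comap f) κ := by
  obtain ⟨pos, hpos, hκ⟩ := h
  refine ⟨pos ∘ f, hpos.comp hf, fun v => le_trans ?_ (hκ (f v))⟩
  rw [← Set.ncard_image_of_injective _ hf]
  refine Set.ncard_le_ncard ?_ (Set.toFinite _)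
  rintro _ ⟨w, hw, rfl⟩
  exact hw

/-- The number of edges of a degenerate graph. -/
theorem IsDegenerate.length_le {n : ℕ} {G : SimpleGraph (Fin n)} {κ : ℕ} (h : IsDegenerate G κ)
    {es : List (Fin n × Fin n)} (hes : IsEdgeList G es) : es.length ≤ κ * n := by
  classical
  obtain ⟨pos, hpos, hκ⟩ := h
  -- Every edge is oriented towards its later endpoint, so each vertex is the tail of at most `κ`
  -- edges.
  set D : Finset (Fin n × Fin n) :=
    Finset.univ.filter fun p => G.Adj p.1 p.2 ∧ pos p.1 < pos p.2 with hD
  have h1 : es.length = (es.map fun p => s(p.1, p.2)).toFinset.card := by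
    rw [List.toFinset_card_of_nodup hes.1, List.length_map]
  have h2 : (es.map fun p => s(p.1, p.2)).toFinset ⊆ D.image fun p => s(p.1, p.2) := by
    intro e he
    induction e with | _ u v
    have hadj : G.Adj u v := (hes.2 u v).2 (List.mem_toFinset.1 he)
    rw [Finset.mem_image]
    rcases lt_or_gt_of_ne (hpos.ne hadj.ne) with hlt | hlt
    · exact ⟨(u, v), by simp [hD, hadj, hlt], rfl⟩
    · exact ⟨(v, u), by simp [hD, hadj.symm, hlt], Sym2.eq_swap⟩
  have h3 : D.card ≤ κ * n := by
    have := Finset.card_le_mul_card_image_of_maps_to (s := D) (t := Finset.univ) (f := Prod.fst)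
      (fun _ _ => Finset.mem_univ _) κ (fun v _ => by
        refine le_trans ?_ (hκ v)
        rw [← Set.ncard_coe_finset]
        refine Set.ncard_le_ncard_of_injOn Prod.snd ?_ ?_ (Set.toFinite _)
        · rintro ⟨a, b⟩ hab
          simp only [hD, Finset.coe_filter, Finset.mem_filter, Finset.mem_univ, true_and,
            Set.mem_ofPred_eq] at hab
          obtain ⟨hab, rfl⟩ := hab
          exact hab
        · rintro ⟨a, b⟩ hab ⟨a', b'⟩ hab' heq
          simp only [Finset.coe_filter, Set.mem_ofPred_eq] at hab hab' heq
          rw [Prod.mk.injEq]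
          exact ⟨hab.2.trans hab'.2.symm, heq⟩)
    simpa using this
  rw [h1]
  exact ((Finset.card_le_card h2).trans Finset.card_image_le).trans h3

/-- Order the points over `S` by the position of their coordinate in `G`, ties broken by the fiber,
and put the single points last. A later neighbor is then one of at most `k` single points, or, for a
point over `S`, lies over one of at most `κ` later neighbors in `G`, in one of at most `k` fibers.
Single points have no later neighbors over `S`. -/
theorem IsDegenerate.blowup {V : Type*} [Fintype V] (H : SimpleGraph V) (S : Set V) {n κ : ℕ}
    {G : SimpleGraph (Fin n)} (h : IsDegenerate G κ) :
    IsDegenerate (blowup H S G) (Fintype.card V * κ + Fintype.card V) := by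
  classical
  obtain ⟨pos, hpos, hκ⟩ := h
  set k := Fintype.card V with hk
  have e : V ≃ Fin k := Fintype.equivFin V
  -- The sum bounds each single position, so `M` exceeds every rank of a point over `S`.
  set M := k * (∑ v, pos v + 1) with hM
  have hMpos : ∀ (x : Fin n) (i : Fin k), k * pos x + i < M := by
    intro x i
    have : pos x ≤ ∑ v, pos v := Finset.single_le_sum (fun _ _ => Nat.zero_le _) (Finset.mem_univ x)
    have := i.2
    nlinarith
  have hdiv : ∀ (a a' : ℕ) (i i' : Fin k), k * a + i = k * a' + i' → a = a' ∧ i = i' := by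
    intro a a' i i' heq
    have hk0 : 0 < k := i.pos
    have h1 := congrArg (· / k) heq
    simp only [Nat.mul_add_div hk0, Nat.div_eq_of_lt i.2, Nat.div_eq_of_lt i'.2, add_zero] at h1
    subst h1
    exact ⟨rfl, Fin.ext (by omega)⟩
  have hx : ∀ x : Σ v : V, Fin (fiberSize S n v), x.1 ∈ S → (x.2 : ℕ) < n := fun x =>
    snd_lt_of_mem
  have hx0 : ∀ x : Σ v : V, Fin (fiberSize S n v), x.1 ∉ S → (x.2 : ℕ) = 0 := fun x =>
    snd_eq_zero_of_notMem
  have hext : ∀ x y : Σ v : V, Fin (fiberSize S n v), x.1 = y.1 → (x.2 : ℕ) = y.2 → x = y := by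
    rintro ⟨v, x⟩ ⟨_, y⟩ rfl hxy
    exact congrArg _ (Fin.ext hxy)
  let rank : (Σ v : V, Fin (fiberSize S n v)) → ℕ := fun x =>
    if h : x.1 ∈ S then k * pos ⟨x.2, hx x h⟩ + e x.1 else M + e x.1
  have rank_mem : ∀ x (h : x.1 ∈ S), rank x = k * pos ⟨x.2, hx x h⟩ + e x.1 := fun x h => dif_pos h
  have rank_notMem : ∀ x, x.1 ∉ S → rank x = M + e x.1 := fun x h => dif_neg h
  refine ⟨rank, ?_, ?_⟩
  · intro x y hxy
    by_cases h1 : x.1 ∈ S <;> by_cases h2 : y.1 ∈ S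
    · rw [rank_mem x h1, rank_mem y h2] at hxy
      obtain ⟨h3, h4⟩ := hdiv _ _ _ _ hxy
      exact hext x y (e.injective h4) (Fin.mk.inj_iff.1 (hpos h3))
    · rw [rank_mem x h1, rank_notMem y h2] at hxy
      have := hMpos ⟨x.2, hx x h1⟩ (e x.1)
      omega
    · rw [rank_notMem x h1, rank_mem y h2] at hxy
      have := hMpos ⟨y.2, hx y h2⟩ (e y.1)
      omega
    · rw [rank_notMem x h1, rank_notMem y h2] at hxy
      exact hext x y (e.injective (Fin.ext (by omega))) (by rw [hx0 x h1, hx0 y h2])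
  · intro x
    set N₁ := {y | (_root_.blowup H S G).Adj x y ∧ rank x < rank y ∧ y.1 ∈ S} with hN₁
    set N₂ : Set (Σ v : V, Fin (fiberSize S n v)) := {y | y.1 ∉ S} with hN₂
    have hsub : {y | (_root_.blowup H S G).Adj x y ∧ rank x < rank y} ⊆ N₁ ∪ N₂ := by
      rintro y ⟨h1, h2⟩
      by_cases h3 : y.1 ∈ S
      · exact Or.inl ⟨h1, h2, h3⟩
      · exact Or.inr h3
    have hN₂card : N₂.ncard ≤ k := by
      have := Set.ncard_le_ncard_of_injOn (s := N₂) (t := Set.univ) Sigma.fst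
        (fun _ _ => Set.mem_univ _)
        (fun y hy z hz hyz => hext y z hyz (by rw [hx0 y hy, hx0 z hz])) (Set.toFinite _)
      rwa [Set.ncard_univ, Nat.card_eq_fintype_card] at this
    have hN₁card : N₁.ncard ≤ k * κ := by
      by_cases h1 : x.1 ∈ S
      · set t : Set (V × Fin n) :=
          Set.univ ×ˢ {w | G.Adj ⟨x.2, hx x h1⟩ w ∧ pos ⟨x.2, hx x h1⟩ < pos w} with ht
        have htc : t.ncard ≤ k * κ := by
          rw [ht, Set.ncard_prod, Set.ncard_univ, Nat.card_eq_fintype_card]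
          exact Nat.mul_le_mul_left _ (hκ _)
        refine le_trans ?_ htc
        have hn : 0 < n := lt_of_le_of_lt (Nat.zero_le _) (hx x h1)
        -- The value `⟨0, hn⟩` is a dummy, as all points of `N₁` lie over `S`.
        refine Set.ncard_le_ncard_of_injOn
          (fun y => (y.1, if h : y.1 ∈ S then ⟨y.2, hx y h⟩ else ⟨0, hn⟩)) ?_ ?_ (Set.toFinite _)
        · rintro y ⟨hadj, hr, hy⟩
          obtain ⟨a, b, hab, ha, hb⟩ := hadj.2 h1 hy
          have ha' : a = ⟨x.2, hx x h1⟩ := Fin.ext ha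
          have hb' : b = ⟨y.2, hx y hy⟩ := Fin.ext hb
          rw [ha', hb'] at hab
          simp only [ht, hy, dif_pos, Set.mem_prod, Set.mem_univ, true_and, Set.mem_ofPred_eq]
          -- The ranks only give `≤` because of the tie-breaking; equality is excluded since
          -- adjacent vertices of `G` have distinct positions.
          refine ⟨hab, lt_of_le_of_ne ?_ (hpos.ne hab.ne)⟩
          rw [rank_mem x h1, rank_mem y hy] at hr
          by_contra hlt
          push Not at hlt
          have := (e y.1).2
          nlinarith
        · rintro y ⟨_, _, hy⟩ z ⟨_, _, hz⟩ hyz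
          simp only [hy, hz, dif_pos, Prod.mk.injEq, Fin.mk.injEq] at hyz
          exact hext y z hyz.1 hyz.2
      · have : N₁ = ∅ := by
          ext y
          simp only [hN₁, Set.mem_ofPred_eq, Set.mem_empty_iff_false, iff_false, not_and]
          intro _ hr hy
          rw [rank_notMem x h1, rank_mem y hy] at hr
          have := hMpos ⟨y.2, hx y hy⟩ (e y.1)
          omega
        simp [this]
    calc _ ≤ (N₁ ∪ N₂).ncard := Set.ncard_le_ncard hsub (Set.toFinite _)
      _ ≤ N₁.ncard + N₂.ncard := Set.ncard_union_le _ _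
      _ ≤ _ := Nat.add_le_add hN₁card hN₂card

/-! ### The restrictions of the blow-up as input graphs -/

section Encoding

variable {t : ℕ} (f : Fin t → ℕ)

/-- The number of the first element of the `i`-th summand of a disjoint union. -/
def fiberOffset (i : Fin t) : ℕ := ∑ j ∈ Finset.Iio i, f j

theorem fiberOffset_add_le {i j : Fin t} (h : i < j) : fiberOffset f i + f i ≤ fiberOffset f j := by
  unfold fiberOffset
  rw [add_comm, ← Finset.sum_insert (by simp)]
  refine Finset.sum_le_sum_of_subset fun k hk => ?_
  rw [Finset.mem_insert, Finset.mem_Iio] at hk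
  rw [Finset.mem_Iio]
  rcases hk with rfl | hk
  exacts [h, hk.trans h]

theorem fiberOffset_add_le_sum (i : Fin t) : fiberOffset f i + f i ≤ ∑ j, f j := by
  unfold fiberOffset
  rw [add_comm, ← Finset.sum_insert (by simp)]
  exact Finset.sum_le_sum_of_subset (Finset.subset_univ _)

theorem fiberOffset_lt {i j : Fin t} (h : i < j) {x y : ℕ} (hx : x < f i) :
    fiberOffset f i + x < fiberOffset f j + y := by
  have := fiberOffset_add_le f h
  omega

theorem fiberOffset_inj {i j : Fin t} {x y : ℕ} (hx : x < f i) (hy : y < f j)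
    (h : fiberOffset f i + x = fiberOffset f j + y) : i = j ∧ x = y := by
  rcases lt_trichotomy i j with hij | rfl | hij
  · exact absurd h (fiberOffset_lt f hij hx).ne
  · exact ⟨rfl, by omega⟩
  · exact absurd h (fiberOffset_lt f hij hy).ne'

/-- The elements of a disjoint union are numbered one summand after the other. -/
noncomputable def fiberEquiv {N : ℕ} (hN : ∑ i, f i = N) : (Σ i, Fin (f i)) ≃ Fin N :=
  Equiv.ofBijective
    (fun x => ⟨fiberOffset f x.1 + x.2, by
      have := fiberOffset_add_le_sum f x.1
      have := x.2.2
      omega⟩)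
    ((Fintype.bijective_iff_injective_and_card _).2 ⟨by
      rintro ⟨i, x⟩ ⟨j, y⟩ h
      obtain ⟨rfl, h2⟩ := fiberOffset_inj f x.2 y.2 (Fin.mk.inj_iff.1 h)
      exact congrArg _ (Fin.ext h2), by simp [hN]⟩)

theorem fiberEquiv_apply {N : ℕ} (hN : ∑ i, f i = N) (x : Σ i, Fin (f i)) :
    (fiberEquiv f hN x : ℕ) = fiberOffset f x.1 + x.2 := rfl

end Encoding

theorem exists_list_map_val {N : ℕ} (L : List (ℕ × ℕ)) (hL : ∀ p ∈ L, p.1 < N ∧ p.2 < N) :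
    ∃ es : List (Fin N × Fin N), es.map (fun p => ((p.1 : ℕ), (p.2 : ℕ))) = L :=
  ⟨L.pmap (fun p h => (⟨p.1, h.1⟩, ⟨p.2, h.2⟩)) hL, by simp [List.map_pmap]⟩

theorem map_range_getD {α : Type*} (l : List α) (g : α → ℕ) (h : α → ℕ) (k k' : ℕ) :
    (List.range l.length).map (fun i => ((l.map g).getD i 0 + k, (l.map h).getD i 0 + k')) =
      l.map fun p => (g p + k, h p + k') := by
  refine List.ext_getElem (by simp) fun i h1 h2 => ?_
  have hi : i < l.length := by simpa using h1
  simp [hi]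

section Restriction

open WordRAM

variable {V : Type*} (H : SimpleGraph V) (S : Set V) {t : ℕ} (u : Fin t → V)

open Classical in
/-- The number of fibers of size `n` before the `i`-th one. -/
noncomputable def offsetSlope (i : Fin t) : ℕ := ((Finset.Iio i).filter fun j => u j ∈ S).card

open Classical in
/-- The number of fibers of size `1` before the `i`-th one. -/
noncomputable def offsetShift (i : Fin t) : ℕ := ((Finset.Iio i).filter fun j => u j ∉ S).card

theorem sum_fiberSize (n : ℕ) (I : Finset (Fin t)) [DecidablePred fun j => u j ∈ S] :
    ∑ j ∈ I, fiberSize S n (u j) =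
      (I.filter fun j => u j ∈ S).card * n + (I.filter fun j => u j ∉ S).card := by
  rw [← Finset.sum_filter_add_sum_filter_not I (fun j => u j ∈ S)]
  congr 1
  · rw [Finset.sum_congr rfl fun j hj => fiberSize_of_mem (Finset.mem_filter.1 hj).2 n]
    simp
  · rw [Finset.sum_congr rfl fun j hj => fiberSize_of_notMem (Finset.mem_filter.1 hj).2 n]
    simp

/-- The coefficients do not depend on `n`, so they can be constants of a fixed program. -/
theorem fiberOffset_eq (n : ℕ) (i : Fin t) :
    fiberOffset (fun j => fiberSize S n (u j)) i = offsetSlope S u i * n + offsetShift S u i := by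
  classical
  rw [fiberOffset, sum_fiberSize, offsetSlope, offsetShift]

open Classical in
/-- The pairs of fibers that are joined by edges. -/
noncomputable def adjPairs : List (Fin t × Fin t) :=
  (Finset.univ.filter fun p : Fin t × Fin t => p.1 < p.2 ∧ H.Adj (u p.1) (u p.2)).toList

open Classical in
/-- The arrays and lengths that describe the edges between two fibers. -/
noncomputable def pairShapes (p : Fin t × Fin t) : List (ℕ × ℕ × ℕ) :=
  -- Two large fibers need each edge of `G` in both orientations. A large fiber and a point are
  -- joined completely: array `3` lists the numbers below `n`, array `2` is zero, register `0` holds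
  -- `n`. Two points give one edge, counted by the `1` in register `2`.
  if u p.1 ∈ S then if u p.2 ∈ S then [(0, 1, 1), (1, 0, 1)] else [(3, 2, 0)]
  else if u p.2 ∈ S then [(2, 3, 0)] else [(2, 2, 2)]

/-- The description of the edges between two fibers. -/
noncomputable def pairSources (p : Fin t × Fin t) : List Source :=
  (pairShapes S u p).map fun a => ⟨a.1, a.2.1, a.2.2, offsetSlope S u p.1, offsetShift S u p.1,
    offsetSlope S u p.2, offsetShift S u p.2⟩

/-- The edges between two fibers. -/
noncomputable def pairEdges {n : ℕ} (es : List (Fin n × Fin n)) (p : Fin t × Fin t) :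
    List (ℕ × ℕ) :=
  (pairShapes S u p).flatMap fun a => (List.range (regVal n es.length a.2.2)).map fun i =>
    (sourceArr es n a.1 i, sourceArr es n a.2.1 i)

open Classical in
/-- The task for the restriction of the blow-up to the fibers of the vertices `u i`. -/
noncomputable def restrictionTask (pos : Bool) : Task where
  pos := pos
  slope := (Finset.univ.filter fun j => u j ∈ S).card
  shift := (Finset.univ.filter fun j => u j ∉ S).card
  sources := (adjPairs H u).flatMap (pairSources S u)

theorem restrictionTask_size (pos : Bool) (n : ℕ) :
    (restrictionTask H S u pos).size n = ∑ i, fiberSize S n (u i) := by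
  classical
  rw [sum_fiberSize, Task.size, restrictionTask]

theorem restrictionTask_length_sources (pos : Bool) :
    (restrictionTask H S u pos).sources.length ≤ 2 * t ^ 2 := by
  classical
  have h1 : ∀ p, (pairSources S u p).length ≤ 2 := fun p => by
    unfold pairSources pairShapes
    split_ifs <;> simp
  have h2 : (adjPairs H u).length ≤ t ^ 2 := by
    unfold adjPairs
    rw [Finset.length_toList]
    refine (Finset.card_filter_le _ _).trans ?_
    simp [sq]
  rw [restrictionTask, List.length_flatMap]
  calc _ ≤ ((adjPairs H u).map fun _ => 2).sum := List.sum_le_sum fun p _ => h1 p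
    _ ≤ _ := by simp; omega

variable {n : ℕ} {G : SimpleGraph (Fin n)} {es : List (Fin n × Fin n)}

theorem restrictionTask_edges (pos : Bool) (f : Fin t → ℕ) (hf : f = fun i => fiberSize S n (u i)) :
    (restrictionTask H S u pos).edges n es.length (sourceArr es n) =
      (adjPairs H u).flatMap fun p => (pairEdges S u es p).map fun e =>
        (fiberOffset f p.1 + e.1, fiberOffset f p.2 + e.2) := by
  subst hf
  rw [Task.edges, restrictionTask, List.flatMap_assoc]
  refine List.flatMap_congr fun p _ => ?_
  rw [pairSources, pairEdges, List.flatMap_map, List.map_flatMap]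
  refine List.flatMap_congr fun a _ => ?_
  simp [Source.edges, Source.edge, fiberOffset_eq, Function.comp_def, add_comm]

/-- A pair common to both halves would come from entries with the same unordered edge, hence from a
single entry, which would be a loop. -/
theorem IsEdgeList.nodup_pairs (hes : IsEdgeList G es) :
    (es.map (fun p => ((p.1 : ℕ), (p.2 : ℕ))) ++
      es.map fun p => ((p.2 : ℕ), (p.1 : ℕ))).Nodup := by
  have h0 : es.Nodup := hes.1.of_map
  rw [List.nodup_append']
  refine ⟨h0.map ?_, h0.map ?_, ?_⟩
  · rintro ⟨a, b⟩ ⟨a', b'⟩ h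
    simp only [Prod.mk.injEq, Fin.val_inj] at h
    rw [h.1, h.2]
  · rintro ⟨a, b⟩ ⟨a', b'⟩ h
    simp only [Prod.mk.injEq, Fin.val_inj] at h
    rw [h.1, h.2]
  · intro e h1 h2
    obtain ⟨p, hp, rfl⟩ := List.mem_map.1 h1
    obtain ⟨q, hq, hqp⟩ := List.mem_map.1 h2
    simp only [Prod.mk.injEq, Fin.val_inj] at hqp
    have hpq : p = q := List.inj_on_of_nodup_map hes.1 hp hq
      (by rw [← hqp.1, ← hqp.2]; exact Sym2.eq_swap)
    have hadj : G.Adj p.1 p.2 := (hes.2 _ _).2 (List.mem_map.2 ⟨p, hp, rfl⟩)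
    rw [hpq] at hadj hqp
    exact hadj.ne hqp.2

theorem IsEdgeList.mem_pairs (hes : IsEdgeList G es) (x y : ℕ) :
    (x, y) ∈ es.map (fun p => ((p.1 : ℕ), (p.2 : ℕ))) ++ es.map (fun p => ((p.2 : ℕ), (p.1 : ℕ))) ↔
      natAdj G x y := by
  simp only [List.mem_append, List.mem_map, Prod.mk.injEq]
  constructor
  · rintro (⟨p, hp, rfl, rfl⟩ | ⟨p, hp, rfl, rfl⟩)
    · exact ⟨_, _, (hes.2 _ _).2 (List.mem_map.2 ⟨p, hp, rfl⟩), rfl, rfl⟩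
    · exact ⟨_, _, ((hes.2 _ _).2 (List.mem_map.2 ⟨p, hp, rfl⟩)).symm, rfl, rfl⟩
  · rintro ⟨a, b, hab, rfl, rfl⟩
    obtain ⟨p, hp, he⟩ := List.mem_map.1 ((hes.2 _ _).1 hab)
    rcases Sym2.eq_iff.1 he with ⟨h1, h2⟩ | ⟨h1, h2⟩
    · exact Or.inl ⟨p, hp, by rw [h1], by rw [h2]⟩
    · exact Or.inr ⟨p, hp, by rw [h2], by rw [h1]⟩

/-- This is adjacency in the blow-up without the condition on `H`, which `adjPairs` supplies. -/
theorem pairEdges_spec (hes : IsEdgeList G es) (p : Fin t × Fin t) :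
    (pairEdges S u es p).Nodup ∧ ∀ x y, (x, y) ∈ pairEdges S u es p ↔
      x < fiberSize S n (u p.1) ∧ y < fiberSize S n (u p.2) ∧
        (u p.1 ∈ S → u p.2 ∈ S → natAdj G x y) := by
  have hrange : ∀ g : ℕ → ℕ × ℕ, (∀ i i', g i = g i' → i = i') →
      ((List.range n).map g).Nodup := fun g hg => List.nodup_range.map hg
  by_cases h1 : u p.1 ∈ S <;> by_cases h2 : u p.2 ∈ S
  · have e : pairEdges S u es p = es.map (fun p => ((p.1 : ℕ), (p.2 : ℕ))) ++
        es.map (fun p => ((p.2 : ℕ), (p.1 : ℕ))) := by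
      have e1 := map_range_getD es (fun p => (p.1 : ℕ)) (fun p => (p.2 : ℕ)) 0 0
      have e2 := map_range_getD es (fun p => (p.2 : ℕ)) (fun p => (p.1 : ℕ)) 0 0
      simp only [add_zero] at e1 e2
      rw [← e1, ← e2]
      simp only [pairEdges, pairShapes, h1, h2, if_true, List.flatMap_cons, List.flatMap_nil,
        List.append_nil, regVal, sourceArr, one_ne_zero, if_false]
    rw [e, fiberSize_of_mem h1, fiberSize_of_mem h2]
    refine ⟨hes.nodup_pairs, fun x y => ?_⟩
    rw [hes.mem_pairs]
    refine ⟨fun h => ?_, fun h => h.2.2 h1 h2⟩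
    obtain ⟨a, b, _, rfl, rfl⟩ := id h
    exact ⟨a.2, b.2, fun _ _ => h⟩
  · have e : pairEdges S u es p = (List.range n).map fun i => (i, 0) := by
      simp only [pairEdges, pairShapes, h1, h2, if_true, if_false, List.flatMap_cons,
        List.flatMap_nil, List.append_nil, regVal]
      refine List.map_congr_left fun i hi => ?_
      rw [List.mem_range] at hi
      simp [sourceArr, hi]
    rw [e, fiberSize_of_mem h1, fiberSize_of_notMem h2]
    refine ⟨hrange _ (by simp), fun x y => ?_⟩
    simp [h2, eq_comm]
  · have e : pairEdges S u es p = (List.range n).map fun i => (0, i) := by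
      simp only [pairEdges, pairShapes, h1, h2, if_true, if_false, List.flatMap_cons,
        List.flatMap_nil, List.append_nil, regVal]
      refine List.map_congr_left fun i hi => ?_
      rw [List.mem_range] at hi
      simp [sourceArr, hi]
    rw [e, fiberSize_of_notMem h1, fiberSize_of_mem h2]
    refine ⟨hrange _ (by simp), fun x y => ?_⟩
    simp [h1, eq_comm, and_comm]
  · have e : pairEdges S u es p = [(0, 0)] := by
      simp [pairEdges, pairShapes, h1, h2, regVal, sourceArr]
    rw [e, fiberSize_of_notMem h1, fiberSize_of_notMem h2]
    simp [h1]

/-- The restriction of the blow-up to the fibers of the vertices `u i`. -/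
noncomputable def restriction (G : SimpleGraph (Fin n)) {N : ℕ}
    (hN : ∑ i, fiberSize S n (u i) = N) : SimpleGraph (Fin N) :=
  (blowup H S G).comap fun a =>
    Sigma.map u (fun _ => id) ((fiberEquiv (fun i => fiberSize S n (u i)) hN).symm a)

variable {u} in
theorem restriction_map_injective (hu : u.Injective) {N : ℕ}
    (hN : ∑ i, fiberSize S n (u i) = N) : Function.Injective fun a =>
      (Sigma.map u (fun _ => id) ((fiberEquiv (fun i => fiberSize S n (u i)) hN).symm a) :
        Σ v, Fin (fiberSize S n v)) :=
  (hu.sigma_map fun _ => Function.injective_id).comp (Equiv.injective _)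

theorem restriction_adj {N : ℕ} (hN : ∑ i, fiberSize S n (u i) = N)
    (x y : Σ i, Fin (fiberSize S n (u i))) :
    (restriction H S u G hN).Adj (fiberEquiv (fun i => fiberSize S n (u i)) hN x)
        (fiberEquiv (fun i => fiberSize S n (u i)) hN y) ↔
      H.Adj (u x.1) (u y.1) ∧ (u x.1 ∈ S → u y.1 ∈ S → natAdj G x.2 y.2) := by
  change (blowup H S G).Adj (Sigma.map u _ (Equiv.symm _ _)) (Sigma.map u _ (Equiv.symm _ _)) ↔ _
  rw [Equiv.symm_apply_apply, Equiv.symm_apply_apply]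
  rfl

theorem mem_restrictionTask_edges (hes : IsEdgeList G es) (pos : Bool) {N : ℕ}
    (hN : ∑ i, fiberSize S n (u i) = N) (a b : ℕ) :
    (a, b) ∈ (restrictionTask H S u pos).edges n es.length (sourceArr es n) ↔
      ∃ x y : Σ i, Fin (fiberSize S n (u i)), x.1 < y.1 ∧
        (restriction H S u G hN).Adj (fiberEquiv (fun i => fiberSize S n (u i)) hN x)
          (fiberEquiv (fun i => fiberSize S n (u i)) hN y) ∧
        (fiberEquiv (fun i => fiberSize S n (u i)) hN x : ℕ) = a ∧
        (fiberEquiv (fun i => fiberSize S n (u i)) hN y : ℕ) = b := by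
  rw [restrictionTask_edges H S u pos _ rfl]
  simp only [restriction_adj, fiberEquiv_apply, List.mem_flatMap, List.mem_map, Prod.mk.injEq]
  constructor
  · rintro ⟨⟨i, j⟩, hp, ⟨x, y⟩, hxy, rfl, rfl⟩
    obtain ⟨hij, hH⟩ : i < j ∧ H.Adj (u i) (u j) := by simpa [adjPairs] using hp
    obtain ⟨hx, hy, h⟩ := ((pairEdges_spec S u hes (i, j)).2 x y).1 hxy
    exact ⟨⟨i, x, hx⟩, ⟨j, y, hy⟩, hij, ⟨hH, h⟩, rfl, rfl⟩
  · rintro ⟨⟨i, x⟩, ⟨j, y⟩, hij, ⟨hH, h⟩, rfl, rfl⟩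
    refine ⟨(i, j), by simpa [adjPairs] using ⟨hij, hH⟩, (x, y), ?_, rfl, rfl⟩
    exact ((pairEdges_spec S u hes (i, j)).2 x y).2 ⟨x.2, y.2, h⟩

/-- Lists for different pairs of fibers are disjoint because the number of a vertex determines its
fiber. -/
theorem nodup_restrictionTask_edges (hes : IsEdgeList G es) (pos : Bool) :
    ((restrictionTask H S u pos).edges n es.length (sourceArr es n)).Nodup := by
  rw [restrictionTask_edges H S u pos _ rfl, List.nodup_flatMap]
  constructor
  · intro p _
    refine (pairEdges_spec S u hes p).1.map ?_
    rintro ⟨a, b⟩ ⟨a', b'⟩ h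
    simpa using h
  · have hnd : (adjPairs H u).Nodup := Finset.nodup_toList _
    refine hnd.imp fun {p q} hpq => ?_
    intro e h1 h2
    obtain ⟨⟨x, y⟩, hxy, rfl⟩ := List.mem_map.1 h1
    obtain ⟨⟨x', y'⟩, hxy', heq⟩ := List.mem_map.1 h2
    obtain ⟨hx, hy, -⟩ := ((pairEdges_spec S u hes p).2 x y).1 hxy
    obtain ⟨hx', hy', -⟩ := ((pairEdges_spec S u hes q).2 x' y').1 hxy'
    simp only [Prod.mk.injEq] at heq
    have e1 := (fiberOffset_inj (fun i => fiberSize S n (u i)) hx' hx heq.1).1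
    have e2 := (fiberOffset_inj (fun i => fiberSize S n (u i)) hy' hy heq.2).1
    exact hpq (Prod.ext e1.symm e2.symm)

/-- The task builds the restriction of the blow-up. -/
theorem exists_isEdgeList_restriction (hes : IsEdgeList G es) (pos : Bool) {N : ℕ}
    (hN : ∑ i, fiberSize S n (u i) = N) :
    ∃ es' : List (Fin N × Fin N), es'.map (fun p => ((p.1 : ℕ), (p.2 : ℕ))) =
      (restrictionTask H S u pos).edges n es.length (sourceArr es n) ∧
      IsEdgeList (restriction H S u G hN) es' := by
  have hmem := mem_restrictionTask_edges H S u hes pos hN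
  have hnd := nodup_restrictionTask_edges H S u hes pos
  obtain ⟨es', hes'⟩ := exists_list_map_val (N := N)
    ((restrictionTask H S u pos).edges n es.length (sourceArr es n)) (by
      rintro ⟨a, b⟩ hab
      obtain ⟨x, y, -, -, rfl, rfl⟩ := (hmem a b).1 hab
      exact ⟨Fin.is_lt _, Fin.is_lt _⟩)
  have hmem' : ∀ a b : Fin N, (a, b) ∈ es' ↔ ((a : ℕ), (b : ℕ)) ∈
      (restrictionTask H S u pos).edges n es.length (sourceArr es n) := by
    intro a b
    rw [← hes', List.mem_map]
    constructor
    · exact fun h => ⟨_, h, rfl⟩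
    · rintro ⟨⟨a', b'⟩, h, heq⟩
      simp only [Prod.mk.injEq, Fin.val_inj] at heq
      rwa [← heq.1, ← heq.2]
  -- All entries are increasing, so entries with the same unordered edge coincide.
  have hlt : ∀ p ∈ es', p.1 < p.2 := by
    rintro ⟨a, b⟩ h
    obtain ⟨x, y, hxy, -, hx, hy⟩ := (hmem _ _).1 ((hmem' a b).1 h)
    change (a : ℕ) < b
    rw [← hx, ← hy]
    exact fiberOffset_lt (fun i => fiberSize S n (u i)) hxy x.2.2
  refine ⟨es', hes', ?_, ?_⟩
  · rw [← hes'] at hnd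
    refine hnd.of_map.map_on ?_
    intro p hp q hq h
    rcases Sym2.eq_iff.1 h with ⟨h1, h2⟩ | ⟨h1, h2⟩
    · exact Prod.ext h1 h2
    · have h3 := hlt p hp
      have h4 := hlt q hq
      rw [h1, h2] at h3
      exact absurd h4 h3.asymm
  · intro a b
    have key : ∀ a b : Fin N, (a, b) ∈ es' → (restriction H S u G hN).Adj a b := by
      intro a b h
      obtain ⟨x, y, -, hadj, hx, hy⟩ := (hmem _ _).1 ((hmem' a b).1 h)
      rwa [Fin.ext hx, Fin.ext hy] at hadj
    rw [List.mem_map]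
    constructor
    · intro hadj
      obtain ⟨x, rfl⟩ := (fiberEquiv (fun i => fiberSize S n (u i)) hN).surjective a
      obtain ⟨y, rfl⟩ := (fiberEquiv (fun i => fiberSize S n (u i)) hN).surjective b
      -- No edge lies inside a fiber, since `H` has no loops.
      have hne : x.1 ≠ y.1 := by
        intro h
        have := ((restriction_adj H S u hN x y).1 hadj).1
        rw [h] at this
        exact this.ne rfl
      rcases lt_or_gt_of_ne hne with hlt | hlt
      · exact ⟨_, (hmem' _ _).2 ((hmem _ _).2 ⟨x, y, hlt, hadj, rfl, rfl⟩), rfl⟩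
      · exact ⟨_, (hmem' _ _).2 ((hmem _ _).2 ⟨y, x, hlt, hadj.symm, rfl, rfl⟩), Sym2.eq_swap⟩
    · rintro ⟨p, hp, h⟩
      rcases Sym2.eq_iff.1 h with ⟨rfl, rfl⟩ | ⟨rfl, rfl⟩
      · exact key _ _ hp
      · exact (key _ _ hp).symm

theorem restrictionTask_valid (pos : Bool) (n : ℕ) :
    ∀ b ∈ (restrictionTask H S u pos).sources, b.Valid ∧
      b.slope₁ * n + b.shift₁ ≤ (restrictionTask H S u pos).size n ∧
      b.slope₂ * n + b.shift₂ ≤ (restrictionTask H S u pos).size n := by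
  intro b hb
  obtain ⟨p, -, hb⟩ := List.mem_flatMap.1 hb
  obtain ⟨a, ha, rfl⟩ := List.mem_map.1 hb
  rw [restrictionTask_size]
  simp only [← fiberOffset_eq]
  refine ⟨?_, (Nat.le_add_right _ _).trans (fiberOffset_add_le_sum _ p.1),
    (Nat.le_add_right _ _).trans (fiberOffset_add_le_sum _ p.2)⟩
  unfold pairShapes at ha
  unfold Source.Valid
  split_ifs at ha <;> fin_cases ha <;> simp

variable {u}

theorem homCount_restriction [Finite V] (hu : u.Injective) {N : ℕ}
    (hN : ∑ i, fiberSize S n (u i) = N) :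
    homCount H (restriction H S u G hN) =
      Nat.card {φ : H →g blowup H S G // ∀ v, (φ v).1 ∈ Set.range u} := by
  rw [restriction, homCount_comap H _ (restriction_map_injective S hu hN)]
  refine Nat.card_congr (Equiv.subtypeEquivRight fun φ => forall_congr' fun v => ?_)
  obtain ⟨a, x⟩ := φ v
  constructor
  · rintro ⟨y, hy⟩
    exact ⟨_, congrArg Sigma.fst hy⟩
  · rintro ⟨i, rfl⟩
    exact ⟨fiberEquiv (fun i => fiberSize S n (u i)) hN ⟨i, x⟩, by
      beta_reduce
      rw [Equiv.symm_apply_apply]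
      rfl⟩

theorem isDegenerate_restriction [Fintype V] (hu : u.Injective) {N κ : ℕ}
    (hN : ∑ i, fiberSize S n (u i) = N) (h : IsDegenerate G κ) :
    IsDegenerate (restriction H S u G hN) (Fintype.card V * κ + Fintype.card V) :=
  (h.blowup H S).comap (restriction_map_injective S hu hN)

end Restriction

/-! ### The reduction: correctness, word size and running time -/

open WordRAM

theorem WordRAM.Computes.mono {P : Prog} {w w' n r T T' : ℕ} {es : List (Fin n × Fin n)}
    (h : Computes P w n es r T) (hw : w ≤ w') (hT : T ≤ T') : Computes P w' n es r T' :=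
  have key := h.spec.mono hw hT fun _ h _ => h
  ⟨key.fits, key.post, key.time⟩

theorem homCount_le {V : Type*} [Fintype V] (H : SimpleGraph V) {N : ℕ} (G : SimpleGraph (Fin N)) :
    homCount H G ≤ N ^ Fintype.card V := by
  have := Nat.card_le_card_of_injective (fun (φ : H →g G) (v : V) => φ v) DFunLike.coe_injective
  exact this.trans_eq (by rw [Nat.card_fun]; simp)

/-- Empty `V` is treated apart: there `T = ∅` contributes to the sum, but the given program promises
nothing on a graph without vertices. -/
theorem homCount_of_isEmpty {V W : Type*} [IsEmpty V] (H : SimpleGraph V) (G : SimpleGraph W) :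
    homCount H G = 1 := by
  have : Unique (H →g G) :=
    ⟨⟨⟨isEmptyElim, fun {a} => isEmptyElim a⟩⟩, fun φ => by ext v; exact isEmptyElim v⟩
  exact Nat.card_unique

section Reduction

variable {V : Type*} [Fintype V] [DecidableEq V] (H : SimpleGraph V) (S : Set V)

/-- An enumeration of a finite set. -/
noncomputable def enumerate (T : Finset V) (i : Fin T.card) : V := T.equivFin.symm i

omit [Fintype V] [DecidableEq V] in
theorem enumerate_injective (T : Finset V) : (enumerate T).Injective :=
  Subtype.val_injective.comp T.equivFin.symm.injective

omit [Fintype V] [DecidableEq V] in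
theorem range_enumerate (T : Finset V) : Set.range (enumerate T) = T := by
  ext v
  constructor
  · rintro ⟨i, rfl⟩
    exact (T.equivFin.symm i).2
  · intro hv
    exact ⟨T.equivFin ⟨v, hv⟩, by simp [enumerate]⟩

/-- The task for a set of vertices of `H`. -/
noncomputable def subsetTask (T : Finset V) : Task :=
  restrictionTask H S (enumerate T) (decide (Even Tᶜ.card))

/-- The tasks for all nonempty sets of vertices of `H`. -/
noncomputable def subsetList (V : Type*) [Fintype V] [DecidableEq V] : List (Finset V) :=
  (Finset.univ.filter Finset.Nonempty).toList

theorem length_subsetList_le : (subsetList V).length ≤ 2 ^ Fintype.card V := by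
  rw [subsetList, Finset.length_toList]
  exact (Finset.card_filter_le _ _).trans (by simp)

variable {n : ℕ} (G : SimpleGraph (Fin n))

/-- The number of homomorphisms to the part of the blow-up above `T`. -/
noncomputable def subsetCount (T : Finset V) : ℕ :=
  Nat.card {φ : H →g blowup H S G // ∀ v, (φ v).1 ∈ T}

/-- The omitted term `T = ∅` is zero because `V` is nonempty. Over `ℤ` the difference equals `|Aut
H|` times a natural number, so the truncated subtraction and the division are both exact. -/
theorem sum_subsetList [Nonempty V] :
    (((subsetList V).map fun T =>
        if (subsetTask H S T).pos then subsetCount H S G T else 0).sum -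
      ((subsetList V).map fun T =>
        if (subsetTask H S T).pos then 0 else subsetCount H S G T).sum) / Nat.card (H ≃g H) =
      homCount (H.induce S) G := by
  have key := sum_homCount_blowup H S G
  have hd : 0 < Nat.card (H ≃g H) := by
    have : Finite (H ≃g H) := DFunLike.finite _
    exact Nat.card_pos
  have h0 : subsetCount H S G ∅ = 0 := by
    rw [subsetCount, Nat.card_eq_zero]
    left
    refine ⟨fun φ => ?_⟩
    obtain ⟨v⟩ := ‹Nonempty V›
    simpa using φ.2 v
  have hsum : ∀ g : Finset V → ℕ, g ∅ = 0 → ((subsetList V).map g).sum = ∑ T, g T := by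
    intro g hg
    rw [subsetList, Finset.sum_map_toList]
    refine Finset.sum_filter_of_ne fun T _ hT => ?_
    rw [Finset.nonempty_iff_ne_empty]
    rintro rfl
    exact hT hg
  rw [hsum _ (by simp [h0]), hsum _ (by simp [h0])]
  refine Nat.div_eq_of_eq_mul_right hd ?_
  refine Nat.sub_eq_of_eq_add ?_
  zify at key ⊢
  rw [← key, ← Finset.sum_add_distrib]
  refine Finset.sum_congr rfl fun T _ => ?_
  change _ = (-1) ^ _ * (subsetCount H S G T : ℤ) + _
  rcases Nat.even_or_odd Tᶜ.card with h | h
  · simp [subsetTask, restrictionTask, h, h.neg_one_pow]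
  · simp [subsetTask, restrictionTask, Nat.not_even_iff_odd.2 h, h.neg_one_pow]

theorem subsetTask_size_le (T : Finset V) (hn : 1 ≤ n) :
    (subsetTask H S T).size n ≤ Fintype.card V * n := by
  have h1 : ∀ v, fiberSize S n v ≤ n := fun v => by
    unfold fiberSize
    split_ifs <;> omega
  rw [subsetTask, restrictionTask_size]
  calc _ ≤ ∑ _i : Fin T.card, n := Finset.sum_le_sum fun i _ => h1 _
    _ = T.card * n := by simp
    _ ≤ _ := Nat.mul_le_mul_right _ (Finset.card_le_univ T)

theorem one_le_subsetTask_size {T : Finset V} (hT : T.Nonempty) (hn : 1 ≤ n) :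
    1 ≤ (subsetTask H S T).size n := by
  have h1 : ∀ v, 1 ≤ fiberSize S n v := fun v => by
    unfold fiberSize
    split_ifs <;> omega
  rw [subsetTask, restrictionTask_size]
  calc 1 ≤ T.card := hT.card_pos
    _ = ∑ _i : Fin T.card, 1 := by simp
    _ ≤ _ := Finset.sum_le_sum fun i _ => h1 _

theorem subsetTask_length_sources_le (T : Finset V) :
    (subsetTask H S T).sources.length ≤ 2 * Fintype.card V ^ 2 :=
  (restrictionTask_length_sources H S _ _).trans
    (Nat.mul_le_mul_left _ (Nat.pow_le_pow_left (Finset.card_le_univ T) 2))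

variable {G}

theorem subsetTask_solved {P : Prog} {c w κ : ℕ} {f : ℕ → ℕ}
    (hP : ∀ (κ n : ℕ), 1 ≤ n → ∀ G : SimpleGraph (Fin n), IsDegenerate G κ →
      ∀ es : List (Fin n × Fin n), IsEdgeList G es →
        Computes P (c * (Nat.log 2 n + 1)) n es (homCount H G) ((f κ * n : ℕ) : ENNReal))
    (hn : 1 ≤ n) (hG : IsDegenerate G κ) {es : List (Fin n × Fin n)} (hes : IsEdgeList G es)
    {T : Finset V} (hT : T.Nonempty)
    (hw : c * (Nat.log 2 ((subsetTask H S T).size n) + 1) ≤ w) :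
    (subsetTask H S T).Solved P n es.length (sourceArr es n) w (subsetCount H S G T)
      (f (Fintype.card V * κ + Fintype.card V) * (Fintype.card V * n)) := by
  have hN : ∑ i, fiberSize S n (enumerate T i) = (subsetTask H S T).size n :=
    (restrictionTask_size H S _ _ n).symm
  obtain ⟨es', hes', hlist⟩ :=
    exists_isEdgeList_restriction H S (enumerate T) hes (decide (Even Tᶜ.card)) hN
  have hcount : homCount H (restriction H S (enumerate T) G hN) = subsetCount H S G T := by
    rw [homCount_restriction H S (enumerate_injective T), range_enumerate]
    rfl
  have hcomp := (hP _ _ (one_le_subsetTask_size H S hT hn) _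
    (isDegenerate_restriction H S (enumerate_injective T) hN hG) es' hlist).mono hw
    (Nat.mul_le_mul_left _ (subsetTask_size_le H S T hn))
  rw [hcount] at hcomp
  have hlt : (subsetTask H S T).size n < 2 ^ w := by
    simpa [inputStore] using hcomp.fitsIn.1 0
  refine ⟨fun b hb => ?_, es', hes', hcomp⟩
  obtain ⟨h1, h2, h3⟩ := restrictionTask_valid H S (enumerate T) (decide (Even Tᶜ.card)) n b hb
  exact ⟨h1, h2.trans_lt hlt, h3.trans_lt hlt⟩

theorem subsetCount_le (T : Finset V) :
    subsetCount H S G T ≤ ((subsetTask H S T).size n) ^ Fintype.card V := by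
  have hN : ∑ i, fiberSize S n (enumerate T i) = (subsetTask H S T).size n :=
    (restrictionTask_size H S _ _ n).symm
  have hcount : homCount H (restriction H S (enumerate T) G hN) = subsetCount H S G T := by
    rw [homCount_restriction H S (enumerate_injective T), range_enumerate]
    rfl
  rw [← hcount]
  exact homCount_le _ _

end Reduction

theorem lemma1p8 {V : Type*} [Finite V] (H : SimpleGraph V) (hH : HomCntEasy H) :
    ∀ S : Set V, HomCntEasy (H.induce S) := by
  classical
  intro S
  rcases isEmpty_or_nonempty V with hV | hV
  · obtain ⟨P, c, f, hP⟩ := hH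
    refine ⟨P, c, f, fun κ n hn G hG es hes => ?_⟩
    have h := hP κ n hn G hG es hes
    rwa [(homCount_of_isEmpty H G).trans (homCount_of_isEmpty (H.induce S) G).symm] at h
  have := Fintype.ofFinite V
  obtain ⟨P, c, f, hP⟩ := hH
  set k := Fintype.card V with hk
  set d := Nat.card (H ≃g H) with hd
  -- The three summands of the word constant pay for the words of `P` on graphs with at most `k * n`
  -- vertices, for the accumulators (at most `2 ^ k` terms, each at most `2 ^ (k * (L + 1 + k))`),
  -- and for the constant `d`. In the time bound, `26 = 18 + 8` covers the main program, `κ + 2`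
  -- comes from `n + m + 1 ≤ (κ + 2) * n`, and `2 * k ^ 2` bounds the sources per task.
  refine ⟨mainProg P ((subsetList V).map (subsetTask H S)) d,
    c * (k + 1) + (k + k * (k + 1) + 1) + d,
    fun κ => 26 + 2 ^ k * (21 + 51 * (κ + 2) * (2 * k ^ 2) + f (k * κ + k) * k),
    fun κ n hn G hG es hes => ?_⟩
  set L := Nat.log 2 n with hL
  set w := (c * (k + 1) + (k + k * (k + 1) + 1) + d) * (L + 1) with hw
  have hwsplit : w = c * (k + 1) * (L + 1) + (k + k * (k + 1) + 1) * (L + 1) + d * (L + 1) := by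
    rw [hw]; ring
  have hdw : d ≤ w := by
    have : d ≤ d * (L + 1) := Nat.le_mul_of_pos_right _ (by omega)
    omega
  have hbw : k + k * (L + 1 + k) + 1 ≤ w := by
    have : k + k * (L + 1 + k) + 1 ≤ (k + k * (k + 1) + 1) * (L + 1) := by
      linarith [Nat.zero_le ((k * k + k + 1) * L)]
    omega
  have hpow : ∀ {a : ℕ}, a ≤ w → 2 ^ a ≤ 2 ^ w := fun h => Nat.pow_le_pow_right (by norm_num) h
  have hsize : ∀ T : Finset V, (subsetTask H S T).size n < 2 ^ (L + 1 + k) := fun T => by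
    have h1 := subsetTask_size_le H S T hn
    have h2 : n < 2 ^ (L + 1) := Nat.lt_pow_succ_log_self (by norm_num) n
    have h3 : k < 2 ^ k := Nat.lt_two_pow_self
    calc _ ≤ k * n := h1
      _ ≤ 2 ^ k * n := Nat.mul_le_mul_right _ h3.le
      _ < 2 ^ k * 2 ^ (L + 1) := Nat.mul_lt_mul_of_pos_left h2 (by positivity)
      _ = _ := by rw [← pow_add]; congr 1; omega
  have hsum : ∀ g : Finset V → ℕ, (∀ T, g T ≤ subsetCount H S G T) →
      ((subsetList V).map g).sum < 2 ^ w := fun g hg => by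
    have h1 : ∀ T, g T ≤ 2 ^ (k * (L + 1 + k)) := fun T => by
      refine (hg T).trans ((subsetCount_le H S T).trans ?_)
      rw [mul_comm k, pow_mul]
      exact Nat.pow_le_pow_left (hsize T).le _
    calc _ ≤ ((subsetList V).map fun _ => 2 ^ (k * (L + 1 + k))).sum :=
          List.sum_le_sum fun T _ => h1 T
      _ = (subsetList V).length * 2 ^ (k * (L + 1 + k)) := by simp
      _ ≤ 2 ^ k * 2 ^ (k * (L + 1 + k)) := Nat.mul_le_mul_right _ length_subsetList_le
      _ < 2 ^ (k + k * (L + 1 + k) + 1) := by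
          rw [← pow_add]
          exact Nat.pow_lt_pow_right (by norm_num) (by omega)
      _ ≤ _ := hpow hbw
  have hsolved : ∀ T ∈ subsetList V,
      (subsetTask H S T).Solved P n es.length (sourceArr es n) w (subsetCount H S G T)
        (f (k * κ + k) * (k * n)) ∧ (subsetTask H S T).sources.length ≤ 2 * k ^ 2 := by
    intro T hT
    have hT : T.Nonempty := by simpa [subsetList] using hT
    refine ⟨subsetTask_solved H S hP hn hG hes hT ?_, subsetTask_length_sources_le H S T⟩
    have hlog : Nat.log 2 ((subsetTask H S T).size n) ≤ L + k := by
      have := Nat.log_lt_of_lt_pow (by have := one_le_subsetTask_size H S hT hn; omega) (hsize T)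
      omega
    calc _ ≤ c * (L + k + 1) := Nat.mul_le_mul_left _ (by omega)
      _ ≤ c * ((k + 1) * (L + 1)) := Nat.mul_le_mul_left _ (by nlinarith)
      _ ≤ w := by rw [hwsplit, ← mul_assoc, add_assoc]; exact Nat.le_add_right _ _
  have hfit : (inputStore n es).FitsIn w := by
    refine (hP κ n hn G hG es hes).fitsIn.mono ?_
    calc c * (L + 1) ≤ c * (k + 1) * (L + 1) := by
          rw [mul_assoc]
          exact Nat.mul_le_mul_left _ (Nat.le_mul_of_pos_left _ (by omega))
      _ ≤ w := by rw [hwsplit, add_assoc]; exact Nat.le_add_right _ _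
  have key := computes_mainProg (task := subsetTask H S) hn hfit
    (Nat.one_lt_two_pow (by omega)) (Nat.lt_two_pow_self.trans_le (hpow hdw)) hsolved
    (hsum _ fun T => by split_ifs <;> simp) (hsum _ fun T => by split_ifs <;> simp)
  rw [sum_subsetList] at key
  refine key.mono le_rfl ?_
  have hm := hG.length_le hes
  have h1 : 51 * (n + es.length + 1) * (2 * k ^ 2) ≤ 51 * (κ + 2) * (2 * k ^ 2) * n := by
    have : n + es.length + 1 ≤ (κ + 2) * n := by nlinarith
    calc _ ≤ 51 * ((κ + 2) * n) * (2 * k ^ 2) := by gcongr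
      _ = _ := by ring
  calc _ ≤ 26 * n + 2 ^ k * (21 * n + 51 * (κ + 2) * (2 * k ^ 2) * n + f (k * κ + k) * (k * n)) := by
        gcongr
        · omega
        · exact length_subsetList_le
        · omega
    _ = _ := by ring
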